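/- Let $I=[0,1]$ with Lebesgue measure $\lambda$. Let $1=a_0>a_1>a_2>\cdots$ with $a_n\to 0$, and let $\tau:I\to I$ be such that for every $n\ge 0$ the restriction of $\tau$ to $[a_{n+1},a_n)$ is continuous and convex, for every $n\ge 1$ we have $\tau(a_n)=0$ and the right derivative satisfies $\tau'(a_n)>0$, and $\sum_{n\ge1}1/\tau'(a_n)<\infty$ (i.e. $\tau\in\mathcal T_{pc}^{\infty,0}(I)$ and $0$ is the only limit point of the partition points). For $n\ge1$ let $\tau_n(x)=x/a_n$ for $0\le x<a_n$ and $\tau_n(x)=\tau(x)$ for $a_n\le x\le 1$. For a nonsingular map $T:I\to I$ let $P_T$ be its Frobenius--Perron operator on $L^1(I,\lambda)$, defined by $\int_A P_Tf\,d\lambda=\int_{T^{-1}(A)}f\,d\lambda$ for all measurable $A$. For $k\ge 1$ let $J_1,\dots,J_k$ be the partition of $I$ into $k$ equal subintervals, and let the Ulam operator $P_{\tau_n}^{(k)}$ act on step functions $f=\sum_{i=1}^k f_i\chi_{J_i}$ by $$P_{\tau_n}^{(k)}f=\sum_{j=1}^k\Big(\sum_{i=1}^k f_i\,\frac{\lambda(\tau_n^{-1}(J_j)\cap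 J_i)}{\lambda(J_i)}\Big)\chi_{J_j}.$$ Then for all $n,k\ge1$ the operator $P_{\tau_n}^{(k)}$ has exactly one nonnegative fixed point $f_{n,k}$ with $\|f_{n,k}\|_1=1$, and: 1. the family $\{f_{n,k}\}_{n,k\ge1}$ is uniformly bounded in $L^\infty$ and relatively weakly compact in $L^1$; 2. if a sequence $f_{n_j,k_j}$, $j=1,2,\dots$, of members of the family converges weakly in $L^1$ to $f$, then it converges to $f$ in $L^1$ and almost everywhere; if moreover $n_j\to\infty$ and $k_j\to\infty$, then $P_\tau f=f$; 3. $\tau$ has exactly one invariant density $f^*$ ($f^*\ge0$, $\|f^*\|_1=1$, $P_\tau f^*=f^*$), and $f_{n,k}\to f^*$ as $n,k\to\infty$, both in $L^1$ and almost everywhere. -/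

import Mathlib

open MeasureTheory Set Filter Topology
open scoped ENNReal Matrix

noncomputable section

/-- Normalized Lebesgue measure on `I = [0,1]`, viewed as a measure on `ℝ`. -/
def lebI : Measure ℝ := volume.restrict (Icc (0 : ℝ) 1)

/-- The class of piecewise convex maps of `[0,1]` with countably many branches whose partition
points `1 = a 0 > a 1 > a 2 > ⋯` accumulate exactly at `0`. The slope `τ'(a n)` is the derivative
from the right; since `derivWithin` is `0` where there is no derivative, `deriv_pos` includes its
existence. Values of `τ` outside `[0,1]` are irrelevant. -/
structure IsPiecewiseConvexZero (τ : ℝ → ℝ) (a : ℕ → ℝ) : Prop where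
  a_zero : a 0 = 1
  a_anti : StrictAnti a
  a_lim : Tendsto a atTop (𝓝 0)
  mapsTo : MapsTo τ (Icc 0 1) (Icc 0 1)
  branch_cont : ∀ n, ContinuousOn τ (Ico (a (n + 1)) (a n))
  branch_convex : ∀ n, ConvexOn ℝ (Ico (a (n + 1)) (a n)) τ
  branch_zero : ∀ n, 1 ≤ n → τ (a n) = 0
  deriv_pos : ∀ n, 1 ≤ n → 0 < derivWithin τ (Ioi (a n)) (a n)
  summable_inv_deriv : Summable fun n : ℕ => 1 / derivWithin τ (Ioi (a (n + 1))) (a (n + 1))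

/-- The finite-branch approximation `τ_n`: `x / a_n` on `[0, a_n)` and `τ` on `[a_n, 1]`. -/
def approxMap (τ : ℝ → ℝ) (a : ℕ → ℝ) (n : ℕ) (x : ℝ) : ℝ :=
  if x < a n then x / a n else τ x

/-- The push-forward under `T` of the measure `f⁺ dλ`, as a density. -/
def pushDensity (T : ℝ → ℝ) (f : ℝ → ℝ) (x : ℝ) : ℝ :=
  (((lebI.withDensity fun y => ENNReal.ofReal (f y)).map T).rnDeriv lebI x).toReal

/-- The Frobenius-Perron operator `P_T`: the density with respect to `λ` of the push-forward
under `T` of the signed measure `f dλ = f⁺ dλ - f⁻ dλ`. -/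
def frobeniusPerron (T : ℝ → ℝ) (f : ℝ → ℝ) (x : ℝ) : ℝ :=
  pushDensity T f x - pushDensity T (fun y => -f y) x

instance : IsFiniteMeasure lebI := by unfold lebI; infer_instance

/-- The `i`-th of the `k` equal subintervals of `[0,1]`. -/
def cell (k : ℕ) (i : Fin k) : Set ℝ := Ico ((i : ℝ) / k) (((i : ℝ) + 1) / k)

/-- The Ulam matrix `λ(T⁻¹ J_j ∩ J_i) / λ(J_i)`. -/
def ulamMatrix (T : ℝ → ℝ) (k : ℕ) : Matrix (Fin k) (Fin k) ℝ :=
  Matrix.of fun i j => lebI.real (T ⁻¹' cell k j ∩ cell k i) / lebI.real (cell k i)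

/-- The Ulam operator `P_T^{(k)}` on step functions, written as row vectors. -/
def ulamOp (T : ℝ → ℝ) (k : ℕ) (v : Fin k → ℝ) : Fin k → ℝ := v ᵥ* ulamMatrix T k

/-- The step function `∑ i, v i * χ_{J_i}`. -/
def stepFn (k : ℕ) (v : Fin k → ℝ) (x : ℝ) : ℝ :=
  ∑ i : Fin k, (cell k i).indicator (fun _ => v i) x

theorem memLp_stepFn (k : ℕ) (v : Fin k → ℝ) : MemLp (stepFn k v) 1 lebI := by
  unfold stepFn
  refine memLp_finsetSum _ fun i _ => ?_
  exact (memLp_const (v i)).indicator measurableSet_Ico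

/-- The step function as an element of `L¹`. -/
def stepL1 (k : ℕ) (v : Fin k → ℝ) : Lp ℝ 1 lebI := (memLp_stepFn k v).toLp (stepFn k v)

/-- `v` represents a (nonnegative) fixed point of the Ulam operator, normalized in `L¹`. -/
def IsUlamDensity (T : ℝ → ℝ) (k : ℕ) (v : Fin k → ℝ) : Prop :=
  (∀ i, 0 ≤ v i) ∧ ulamOp T k v = v ∧ ‖stepL1 k v‖ = 1

/-- `f` is a probability density fixed by the Frobenius-Perron operator of `T`. -/
def IsInvariantDensity (T : ℝ → ℝ) (f : Lp ℝ 1 lebI) : Prop :=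
  0 ≤ᵐ[lebI] f ∧ ‖f‖ = 1 ∧ frobeniusPerron T f =ᵐ[lebI] f

theorem pushDensity_spec {T f : ℝ → ℝ} (hT : AEMeasurable T lebI)
    (hns : lebI.map T ≪ lebI) (hf : Integrable f lebI) :
    Integrable (pushDensity T f) lebI ∧ ∀ A, MeasurableSet A →
      ∫ x in A, pushDensity T f x ∂lebI = ∫ x in T ⁻¹' A, max (f x) 0 ∂lebI := by
  set ν := lebI.withDensity fun y => ENNReal.ofReal (f y) with hν
  have hfin : IsFiniteMeasure ν := isFiniteMeasure_withDensity_ofReal hf.2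
  have hνac : ν ≪ lebI := withDensity_absolutelyContinuous _ _
  have hT' : AEMeasurable T ν := hT.mono_ac hνac
  have hac : ν.map T ≪ lebI := by
    refine Measure.AbsolutelyContinuous.mk fun s hs h0 => ?_
    have h := hns h0
    rw [Measure.map_apply_of_aemeasurable hT hs] at h
    rw [Measure.map_apply_of_aemeasurable hT' hs]
    exact hνac h
  refine ⟨Measure.integrable_toReal_rnDeriv, fun A hA => ?_⟩
  have h1 : ∫ x in A, pushDensity T f x ∂lebI = (ν.map T).real A :=
    Measure.setIntegral_toReal_rnDeriv hac A
  have hnull : NullMeasurableSet (T ⁻¹' A) lebI := hT.nullMeasurableSet_preimage hA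
  rw [h1, Measure.real, Measure.map_apply_of_aemeasurable hT' hA, hν,
    withDensity_apply₀ _ hnull, integral_eq_lintegral_of_nonneg_ae]
  · congr 1
    refine lintegral_congr fun x => ?_
    rw [ENNReal.ofReal_max]
    simp
  · exact Eventually.of_forall fun x => le_max_right _ _
  · exact (hf.pos_part.1).mono_measure Measure.restrict_le_self

/-- The defining identity of the Frobenius-Perron operator of a nonsingular map. -/
theorem frobeniusPerron_spec {T f : ℝ → ℝ} (hT : AEMeasurable T lebI)
    (hns : lebI.map T ≪ lebI) (hf : Integrable f lebI) :
    Integrable (frobeniusPerron T f) lebI ∧ ∀ A, MeasurableSet A →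
      ∫ x in A, frobeniusPerron T f x ∂lebI = ∫ x in T ⁻¹' A, f x ∂lebI := by
  obtain ⟨h1, h2⟩ := pushDensity_spec hT hns hf
  obtain ⟨h3, h4⟩ := pushDensity_spec hT hns hf.neg
  refine ⟨h1.sub h3, fun A hA => ?_⟩
  have e : ∫ x in A, frobeniusPerron T f x ∂lebI
      = ∫ x in A, pushDensity T f x ∂lebI - ∫ x in A, pushDensity T (-f) x ∂lebI :=
    integral_sub h1.integrableOn h3.integrableOn
  rw [e, h2 A hA, h4 A hA, ← integral_sub hf.pos_part.integrableOn hf.neg.pos_part.integrableOn]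
  refine integral_congr_ae (Eventually.of_forall fun x => ?_)
  simp only [Pi.neg_apply]
  rcases le_total (f x) 0 with h | h
  · rw [max_eq_right h, max_eq_left (by linarith)]; ring
  · rw [max_eq_left h, max_eq_right (by linarith)]; ring

end

/-!
A density on `[0,1]` is decreasing (up to a null set) exactly when its distribution function is
concave, and push-forward under a map all of whose branches are convex and vanish at their left end
points preserves this concavity. Hence the Ulam operators preserve decreasing step functions; such
a step function with unit mass which is fixed is bounded by a constant depending only on
`∑ 1 / τ'(a_n)`. By Helly selection the family of fixed points is relatively compact, convergence of
distribution functions forces convergence of the densities almost everywhere and in `L¹`, and limits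
as `n, k → ∞` are invariant under `τ`.

For uniqueness of the invariant density, split the mass of a step function over its cells. Under
iteration the image of an interval becomes concave except for the points that have always stayed in
the branch of its left end point, and the measure of these tends to `0` as the slopes are unbounded
near `0`. So every invariant density has a concave distribution function. The positive and negative
parts of a difference of two invariant densities are themselves invariant, and two decreasing
densities of equal positive mass cannot have disjoint supports.
-/

open scoped NNReal

theorem ae_lebI_mem_Ioo : ∀ᵐ x ∂lebI, x ∈ Ioo (0 : ℝ) 1 := by
  rw [lebI, ← restrict_Ioo_eq_restrict_Icc]
  exact ae_restrict_mem measurableSet_Ioo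

theorem indicator_Ioo_ae_eq (g : ℝ → ℝ) : (Ioo (0 : ℝ) 1).indicator g =ᵐ[lebI] g := by
  filter_upwards [ae_lebI_mem_Ioo] with x hx using indicator_of_mem hx g

theorem lebI_real_univ : lebI.real univ = 1 := by simp [lebI]

theorem lebI_real_Ico {x y : ℝ} (hx : 0 ≤ x) (hxy : x ≤ y) (hy : y ≤ 1) :
    lebI.real (Ico x y) = y - x := by
  rw [lebI, measureReal_restrict_apply measurableSet_Ico,
    inter_eq_left.2 (Ico_subset_Icc_self.trans (Icc_subset_Icc hx hy)),
    Real.volume_real_Ico_of_le hxy]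

theorem lebI_real_Ico_le {x y : ℝ} (hxy : x ≤ y) : lebI.real (Ico x y) ≤ y - x := by
  rw [lebI, ← Real.volume_real_Ico_of_le hxy]
  exact ENNReal.toReal_mono measure_Ico_lt_top.ne (Measure.restrict_apply_le _ _)

theorem hasSum_measureReal_iUnion {α : Type*} [MeasurableSpace α] {μ : Measure α}
    [IsFiniteMeasure μ] {s : ℕ → Set α} (hd : Pairwise (Function.onFun Disjoint s))
    (hs : ∀ m, MeasurableSet (s m)) : HasSum (fun m => μ.real (s m)) (μ.real (⋃ m, s m)) := by
  simpa only [Measure.toSignedMeasure_apply_measurable, hs, MeasurableSet.iUnion hs] using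
    VectorMeasure.hasSum_of_disjoint_iUnion (v := μ.toSignedMeasure) hs hd

/-- The left-continuous distribution function `t ↦ μ (-∞, t)` of a measure on the line. A measure
with a density has a decreasing density exactly when this function is concave. -/
noncomputable def distFun (μ : Measure ℝ) (t : ℝ) : ℝ := μ.real (Iio t)

theorem distFun_mono (μ : Measure ℝ) [IsFiniteMeasure μ] : Monotone (distFun μ) :=
  fun _ _ h => measureReal_mono (Iio_subset_Iio h)

theorem measureReal_Ico (μ : Measure ℝ) [IsFiniteMeasure μ] {s t : ℝ} (h : s ≤ t) :
    μ.real (Ico s t) = distFun μ t - distFun μ s := by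
  rw [← Iio_sdiff_Iio, measureReal_sdiff (Iio_subset_Iio h) measurableSet_Iio, distFun, distFun]

theorem distFun_of_nonpos {μ : Measure ℝ} (hμ : μ ≪ lebI) {t : ℝ} (ht : t ≤ 0) :
    distFun μ t = 0 := by
  have h0 : lebI (Iio t) = 0 := by
    refine measure_mono_null (Iio_subset_Iio ht) (measure_eq_zero_iff_ae_notMem.2 ?_)
    filter_upwards [ae_lebI_mem_Ioo] with x hx using notMem_Iio.2 hx.1.le
  rw [distFun, Measure.real, hμ h0, ENNReal.toReal_zero]

theorem distFun_of_one_le {μ : Measure ℝ} (hμ : μ ≪ lebI) {t : ℝ} (ht : 1 ≤ t) :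
    distFun μ t = μ.real univ := by
  refine measureReal_congr ?_
  filter_upwards [hμ.ae_le ae_lebI_mem_Ioo] with x hx
  exact propext ⟨fun _ => mem_univ x, fun _ => hx.2.trans_le ht⟩

theorem ext_of_distFun {μ ν : Measure ℝ} [IsFiniteMeasure μ] [IsFiniteMeasure ν]
    (h : distFun μ = distFun ν) : μ = ν := by
  refine Measure.ext_of_Ico μ ν fun s t hst => ?_
  rw [← measureReal_eq_measureReal_iff, measureReal_Ico μ hst.le, measureReal_Ico ν hst.le, h]

/-- The measure `f⁺ dλ`; it is the measure with density `f` when `f` is nonnegative. -/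
noncomputable def densityMeasure (f : ℝ → ℝ) : Measure ℝ :=
  lebI.withDensity fun x => ENNReal.ofReal (f x)

theorem densityMeasure_ac (f : ℝ → ℝ) : densityMeasure f ≪ lebI :=
  withDensity_absolutelyContinuous _ _

theorem isFiniteMeasure_densityMeasure {f : ℝ → ℝ} (hf : Integrable f lebI) :
    IsFiniteMeasure (densityMeasure f) :=
  isFiniteMeasure_withDensity_ofReal hf.2

theorem densityMeasure_real {f : ℝ → ℝ} (hf : Integrable f lebI) (h0 : 0 ≤ᵐ[lebI] f) {A : Set ℝ}
    (hA : MeasurableSet A) : (densityMeasure f).real A = ∫ x in A, f x ∂lebI := by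
  rw [integral_eq_lintegral_of_nonneg_ae (ae_restrict_of_ae h0) hf.1.restrict, densityMeasure,
    Measure.real, withDensity_apply _ hA]

theorem distFun_densityMeasure {f : ℝ → ℝ} (hf : Integrable f lebI) (h0 : 0 ≤ᵐ[lebI] f) (t : ℝ) :
    distFun (densityMeasure f) t = ∫ x in Iio t, f x ∂lebI :=
  densityMeasure_real hf h0 measurableSet_Iio

theorem densityMeasure_real_univ {f : ℝ → ℝ} (hf : Integrable f lebI) (h0 : 0 ≤ᵐ[lebI] f) :
    (densityMeasure f).real univ = ∫ x, f x ∂lebI := by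
  rw [densityMeasure_real hf h0 MeasurableSet.univ, setIntegral_univ]

theorem densityMeasure_Ico_le {f : ℝ → ℝ} (hf : Integrable f lebI) (h0 : 0 ≤ᵐ[lebI] f) {C x y : ℝ}
    (hC : ∀ z ∈ Ico x y, f z ≤ C) (hx : 0 ≤ x) (hxy : x ≤ y) (hy : y ≤ 1) :
    (densityMeasure f).real (Ico x y) ≤ C * (y - x) := by
  rw [densityMeasure_real hf h0 measurableSet_Ico]
  calc ∫ z in Ico x y, f z ∂lebI ≤ ∫ _ in Ico x y, C ∂lebI :=
        setIntegral_mono_on hf.integrableOn (integrable_const C).integrableOn measurableSet_Ico hC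
    _ = C * (y - x) := by
        rw [setIntegral_const, lebI_real_Ico hx hxy hy, smul_eq_mul, mul_comm]

theorem le_densityMeasure_Ico {f : ℝ → ℝ} (hf : Integrable f lebI) (h0 : 0 ≤ᵐ[lebI] f) {c x y : ℝ}
    (hc : ∀ z ∈ Ico x y, c ≤ f z) (hx : 0 ≤ x) (hxy : x ≤ y) (hy : y ≤ 1) :
    c * (y - x) ≤ (densityMeasure f).real (Ico x y) := by
  rw [densityMeasure_real hf h0 measurableSet_Ico]
  calc c * (y - x) = ∫ _ in Ico x y, c ∂lebI := by
        rw [setIntegral_const, lebI_real_Ico hx hxy hy, smul_eq_mul, mul_comm]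
    _ ≤ ∫ z in Ico x y, f z ∂lebI :=
        setIntegral_mono_on (integrable_const c).integrableOn hf.integrableOn measurableSet_Ico hc

theorem concaveOn_distFun_of_antitoneOn {f : ℝ → ℝ} (hf : Integrable f lebI) (h0 : 0 ≤ᵐ[lebI] f)
    (ha : AntitoneOn f (Icc 0 1)) : ConcaveOn ℝ (Icc 0 1) (distFun (densityMeasure f)) := by
  have := isFiniteMeasure_densityMeasure hf
  refine concaveOn_of_slope_anti_adjacent (convex_Icc 0 1) fun {x y z} hx hz hxy hyz => ?_
  have hy : y ∈ Icc (0 : ℝ) 1 := ⟨hx.1.trans hxy.le, hyz.le.trans hz.2⟩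
  rw [← measureReal_Ico _ hyz.le, ← measureReal_Ico _ hxy.le]
  calc (densityMeasure f).real (Ico y z) / (z - y) ≤ f y := by
        rw [div_le_iff₀ (sub_pos.2 hyz)]
        exact densityMeasure_Ico_le hf h0
          (fun w hw => ha hy ⟨hy.1.trans hw.1, hw.2.le.trans hz.2⟩ hw.1) hy.1 hyz.le hz.2
    _ ≤ (densityMeasure f).real (Ico x y) / (y - x) := by
        rw [le_div_iff₀ (sub_pos.2 hxy)]
        exact le_densityMeasure_Ico hf h0
          (fun w hw => ha ⟨hx.1.trans hw.1, hw.2.le.trans hy.2⟩ hy hw.2.le) hx.1 hxy.le hy.2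

theorem exists_mem_Ico_succ_of_tendsto {b : ℕ → ℝ} {l x : ℝ} (lim : Tendsto b atTop (𝓝 l))
    (hl : l < x) (hx : x < b 0) : ∃ m, x ∈ Ico (b (m + 1)) (b m) := by
  obtain ⟨m, hm, hm'⟩ := Nat.exists_not_and_succ_of_not_zero_of_exists
    (p := fun m => b m ≤ x) hx.not_ge ((lim.eventually_lt_const hl).exists.imp fun _ h => h.le)
  exact ⟨m, hm', not_le.1 hm⟩

theorem concaveOn_sSup_sublevel {C D : Set ℝ} {f : ℝ → ℝ} (hf : ConvexOn ℝ C f)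
    (hC : BddAbove C) (hD : Convex ℝ D) (hne : ∀ t ∈ D, {x ∈ C | f x ≤ t}.Nonempty) :
    ConcaveOn ℝ D fun t => sSup {x ∈ C | f x ≤ t} := by
  refine ⟨hD, fun s hs t ht p q hp hq hpq => ?_⟩
  have hbdd : ∀ r, BddAbove {x ∈ C | f x ≤ r} := fun r => hC.mono (sep_subset _ _)
  rw [← Real.sSup_smul_of_nonneg hp, ← Real.sSup_smul_of_nonneg hq,
    ← csSup_add ((hne s hs).smul_set) ((hbdd s).smul_of_nonneg hp) ((hne t ht).smul_set)
      ((hbdd t).smul_of_nonneg hq)]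
  refine csSup_le_csSup (hbdd _) ((hne s hs).smul_set.add (hne t ht).smul_set) ?_
  rintro _ ⟨_, ⟨x, ⟨hx, hxs⟩, rfl⟩, _, ⟨y, ⟨hy, hyt⟩, rfl⟩, rfl⟩
  refine ⟨hf.1 hx hy hp hq hpq, (hf.2 hx hy hp hq hpq).trans ?_⟩
  exact add_le_add (smul_le_smul_of_nonneg_left hxs hp) (smul_le_smul_of_nonneg_left hyt hq)

theorem measurable_of_continuousOn_cover {ι α β : Type*} [Countable ι] [TopologicalSpace α]
    [MeasurableSpace α] [OpensMeasurableSpace α] [TopologicalSpace β] [MeasurableSpace β]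
    [BorelSpace β] {T : α → β} {s : ι → Set α} (hs : ∀ i, MeasurableSet (s i))
    (hcov : ⋃ i, s i = univ) (hT : ∀ i, ContinuousOn T (s i)) : Measurable T := by
  intro A hA
  have hpre : T ⁻¹' A = ⋃ i, Subtype.val '' ((s i).domRestrict T ⁻¹' A) := by
    ext x
    obtain ⟨i, hi⟩ := mem_iUnion.1 (hcov ▸ mem_univ x)
    simp only [mem_preimage, mem_iUnion, mem_image, Subtype.exists, exists_and_right,
      exists_eq_right]
    exact ⟨fun h => ⟨i, hi, h⟩, fun ⟨_, _, h⟩ => h⟩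
  rw [hpre]
  exact MeasurableSet.iUnion fun i => (hs i).subtype_image ((hT i).domRestrict.measurable hA)

/-- `g` is continuous and convex on `[l, r)`, starts at the value `0` and has slope at least
`c > 0`. An empty branch, `r ≤ l`, is allowed. -/
structure IsConvexBranch (g : ℝ → ℝ) (l r c : ℝ) : Prop where
  slope_pos : 0 < c
  continuousOn : ContinuousOn g (Ico l r)
  convexOn : ConvexOn ℝ (Ico l r) g
  map_left : l < r → g l = 0
  slope_le : ∀ x ∈ Ico l r, c * (x - l) ≤ g x

namespace IsConvexBranch

variable {g g' : ℝ → ℝ} {l r c : ℝ}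

theorem congr (h : IsConvexBranch g l r c) (hg : EqOn g' g (Ico l r)) :
    IsConvexBranch g' l r c where
  slope_pos := h.slope_pos
  continuousOn := h.continuousOn.congr hg
  convexOn := h.convexOn.congr hg.symm
  map_left hlr := (hg (left_mem_Ico.2 hlr)).trans (h.map_left hlr)
  slope_le x hx := (h.slope_le x hx).trans_eq (hg hx).symm

theorem mul_sub_le (h : IsConvexBranch g l r c) {x y : ℝ} (hx : x ∈ Ico l r) (hy : y ∈ Ico l r)
    (hxy : x ≤ y) : c * (y - x) ≤ g y - g x := by
  rcases hxy.eq_or_lt with rfl | hxy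
  · simp
  have hlr : l < r := hx.1.trans_lt hx.2
  rcases hx.1.eq_or_lt with rfl | hlx
  · simpa only [h.map_left hlr, sub_zero] using h.slope_le y hy
  · have hslope : c ≤ (g y - g x) / (y - x) :=
      calc c ≤ (g x - g l) / (x - l) := by
            rw [le_div_iff₀ (sub_pos.2 hlx), h.map_left hlr, sub_zero]
            exact h.slope_le x hx
        _ ≤ (g y - g x) / (y - x) :=
            h.convexOn.slope_mono_adjacent (left_mem_Ico.2 hlr) hy hlx hxy
    rwa [le_div_iff₀ (sub_pos.2 hxy)] at hslope

theorem strictMonoOn (h : IsConvexBranch g l r c) : StrictMonoOn g (Ico l r) := by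
  intro x hx y hy hxy
  have := h.mul_sub_le hx hy hxy.le
  have := mul_pos h.slope_pos (sub_pos.2 hxy)
  linarith

theorem map_mul_sub_le (h : IsConvexBranch g l r c) {x y : ℝ} (hx : x ∈ Ico l r)
    (hy : y ∈ Ico l r) (hxy : x ≤ y) : g x * (y - l) ≤ g y * (x - l) := by
  have hl : l ∈ Ico l r := left_mem_Ico.2 (hx.1.trans_lt hx.2)
  rcases hx.1.eq_or_lt with rfl | hlx
  · rw [h.map_left hl.2, zero_mul, sub_self, mul_zero]
  · have hly := hlx.trans_le hxy
    have hsec := h.convexOn.secant_mono hl hx hy hlx.ne' hly.ne' hxy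
    rwa [h.map_left hl.2, sub_zero, sub_zero,
      div_le_div_iff₀ (sub_pos.2 hlx) (sub_pos.2 hly)] at hsec

theorem Ico_subset_image (h : IsConvexBranch g l r c) {x y : ℝ} (hlx : l < x) (hxy : x < y)
    (hyr : y ≤ r) : Ico (g x) (g x * ((y - l) / (x - l))) ⊆ g '' Ico x y := by
  intro z hz
  have hxl : 0 < x - l := sub_pos.2 hlx
  have hmem {w : ℝ} (hw : w ∈ Ico x y) : w ∈ Ico l r := ⟨hlx.le.trans hw.1, hw.2.trans_le hyr⟩
  have hx : x ∈ Ico x y := left_mem_Ico.2 hxy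
  have hgx : 0 < g x := by
    rw [← h.map_left (hlx.trans (hmem hx).2)]
    exact h.strictMonoOn (left_mem_Ico.2 (hlx.trans (hmem hx).2)) (hmem hx) hlx
  set w := l + z * (x - l) / g x with hw
  have hwx : x ≤ w := by
    rw [hw, ← sub_le_iff_le_add', le_div_iff₀ hgx, mul_comm]
    exact mul_le_mul_of_nonneg_right hz.1 hxl.le
  have hwy : w < y := by
    rw [hw, ← lt_sub_iff_add_lt', div_lt_iff₀ hgx, ← lt_div_iff₀ hxl, mul_comm, mul_div_assoc]
    exact hz.2
  have hzw : z ≤ g w := by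
    refine le_of_mul_le_mul_right ?_ hxl
    calc z * (x - l) = g x * (w - l) := by rw [hw]; field_simp; ring
      _ ≤ g w * (x - l) := h.map_mul_sub_le (hmem hx) (hmem ⟨hwx, hwy⟩) hwx
  obtain ⟨u, hu, rfl⟩ := intermediate_value_Icc hwx
    (h.continuousOn.mono fun u hu => hmem ⟨hu.1, hu.2.trans_lt hwy⟩) ⟨hz.1, hzw⟩
  exact ⟨u, ⟨hu.1, hu.2.trans_lt hwy⟩, rfl⟩

theorem indicator_Ioo_eqOn (h : IsConvexBranch g l r c) (hl : 0 ≤ l) (hr : r ≤ 1) :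
    EqOn ((Ioo (0 : ℝ) 1).indicator g) g (Ico l r) := by
  intro x hx
  rcases (hl.trans hx.1).eq_or_lt with rfl | h0
  · obtain rfl : l = 0 := le_antisymm hx.1 hl
    rw [h.map_left hx.2, indicator_of_notMem (fun h0 => h0.1.false) g]
  · exact indicator_of_mem (s := Ioo (0 : ℝ) 1) ⟨h0, hx.2.trans_le hr⟩ g

end IsConvexBranch

theorem isConvexBranch_empty (g : ℝ → ℝ) {c : ℝ} (x : ℝ) (hc : 0 < c) :
    IsConvexBranch g x x c := by
  constructor <;> simp [hc, ConvexOn, convex_empty]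

theorem isConvexBranch_mul {c : ℝ} (hc : 0 < c) (r : ℝ) :
    IsConvexBranch (fun x => c * x) 0 r c where
  slope_pos := hc
  continuousOn := (continuous_const_mul c).continuousOn
  convexOn := (LinearMap.mulLeft ℝ c).convexOn (convex_Ico 0 r)
  map_left _ := mul_zero c
  slope_le x _ := by rw [sub_zero]

/-- A Borel map of `[0,1]` into `[0,1)` whose restriction to each `[b (m+1), b m)` is a convex
branch of slope at least `c m`. Once `b` reaches `0` the remaining branches are empty; if it does,
the last branch is uniformly expanding. This covers both `τ` and its approximations with finitely
many branches. -/
structure IsConvexBranched (T : ℝ → ℝ) (b c : ℕ → ℝ) : Prop where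
  measurable : Measurable T
  mapsTo : ∀ x, T x ∈ Ico (0 : ℝ) 1
  b_zero : b 0 = 1
  anti : Antitone b
  lim : Tendsto b atTop (𝓝 0)
  strict : ∀ m, 0 < b m → b (m + 1) < b m
  branch : ∀ m, IsConvexBranch T (b (m + 1)) (b m) (c m)
  one_lt_last : ∀ m, 0 < b m → b (m + 1) = 0 → 1 < c m

/-- The inverse of the `m`-th branch, extended by the right end point of the branch. The left end
point is inserted so that the supremum is never over the empty set. -/
noncomputable def branchInv (T : ℝ → ℝ) (b : ℕ → ℝ) (m : ℕ) (t : ℝ) : ℝ :=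
  sSup (insert (b (m + 1)) {x ∈ Ico (b (m + 1)) (b m) | T x ≤ t})

namespace IsConvexBranched

variable {T : ℝ → ℝ} {b c : ℕ → ℝ}

theorem b_nonneg (h : IsConvexBranched T b c) (m : ℕ) : 0 ≤ b m := h.anti.le_of_tendsto h.lim m

theorem b_le_one (h : IsConvexBranched T b c) (m : ℕ) : b m ≤ 1 :=
  (h.anti (Nat.zero_le m)).trans_eq h.b_zero

theorem b_succ_le (h : IsConvexBranched T b c) (m : ℕ) : b (m + 1) ≤ b m := h.anti m.le_succ

theorem b_pos_of_mem (h : IsConvexBranched T b c) {m : ℕ} {x : ℝ}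
    (hx : x ∈ Ico (b (m + 1)) (b m)) : 0 < b m :=
  (h.b_nonneg (m + 1)).trans_lt (hx.1.trans_lt hx.2)

theorem left_mem (h : IsConvexBranched T b c) {m : ℕ} (hb : 0 < b m) :
    b (m + 1) ∈ Ico (b (m + 1)) (b m) :=
  left_mem_Ico.2 (h.strict m hb)

theorem exists_branch (h : IsConvexBranched T b c) {x : ℝ} (hx : x ∈ Ioo (0 : ℝ) 1) :
    ∃ m, x ∈ Ico (b (m + 1)) (b m) :=
  exists_mem_Ico_succ_of_tendsto h.lim hx.1 (h.b_zero.symm ▸ hx.2)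

theorem ae_mem_iUnion_branch (h : IsConvexBranched T b c) :
    ∀ᵐ x ∂lebI, x ∈ ⋃ m, Ico (b (m + 1)) (b m) := by
  filter_upwards [ae_lebI_mem_Ioo] with x hx using mem_iUnion.2 (h.exists_branch hx)

theorem map_left (h : IsConvexBranched T b c) {m : ℕ} (hb : 0 < b m) : T (b (m + 1)) = 0 :=
  (h.branch m).map_left (h.strict m hb)

theorem le_of_mem_branchInv_set (h : IsConvexBranched T b c) {m : ℕ} {t x : ℝ}
    (hx : x ∈ insert (b (m + 1)) {x ∈ Ico (b (m + 1)) (b m) | T x ≤ t}) : x ≤ b m :=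
  hx.elim (fun hx => hx.trans_le (h.b_succ_le m)) fun hx => hx.1.2.le

theorem branchInv_mem (h : IsConvexBranched T b c) (m : ℕ) (t : ℝ) :
    branchInv T b m t ∈ Icc (b (m + 1)) (b m) :=
  ⟨le_csSup ⟨b m, fun _ => h.le_of_mem_branchInv_set⟩ (mem_insert _ _),
    csSup_le ⟨_, mem_insert _ _⟩ fun _ => h.le_of_mem_branchInv_set⟩

theorem le_branchInv (h : IsConvexBranched T b c) {m : ℕ} {t x : ℝ}
    (hx : x ∈ Ico (b (m + 1)) (b m)) (hxt : T x ≤ t) : x ≤ branchInv T b m t :=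
  le_csSup ⟨b m, fun _ => h.le_of_mem_branchInv_set⟩ (mem_insert_of_mem _ ⟨hx, hxt⟩)

theorem preimage_Iio_inter_branch (h : IsConvexBranched T b c) (m : ℕ) (t : ℝ) :
    T ⁻¹' Iio t ∩ Ico (b (m + 1)) (b m) = Ico (b (m + 1)) (branchInv T b m t) := by
  ext x
  constructor
  · rintro ⟨hxt, hx⟩
    refine ⟨hx.1, ?_⟩
    have hnear : ∀ᶠ y in 𝓝[>] x, T y < t :=
      (((h.branch m).continuousOn.mono (Ico_subset_Ico_left hx.1)) x (left_mem_Ico.2 hx.2)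
        |>.eventually_lt_const hxt).filter_mono
        (nhdsWithin_Ico_eq_nhdsGE hx.2 ▸ nhdsWithin_mono _ Ioi_subset_Ici_self)
    obtain ⟨y, hy, hxy⟩ := (hnear.and (Ioo_mem_nhdsGT hx.2)).exists
    exact hxy.1.trans_le (h.le_branchInv ⟨hx.1.trans hxy.1.le, hxy.2⟩ hy.le)
  · rintro ⟨hx1, hx2⟩
    obtain ⟨y, rfl | hy, hxy⟩ := exists_lt_of_lt_csSup ⟨_, mem_insert _ _⟩ hx2
    · exact absurd hxy hx1.not_gt
    · have hx : x ∈ Ico (b (m + 1)) (b m) := ⟨hx1, hxy.trans hy.1.2⟩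
      exact ⟨((h.branch m).strictMonoOn hx hy.1 hxy).trans_le hy.2, hx⟩

theorem concaveOn_branchInv (h : IsConvexBranched T b c) (m : ℕ) :
    ConcaveOn ℝ (Ici 0) (branchInv T b m) := by
  rcases (h.b_nonneg m).eq_or_lt with hb | hb
  · have hconst : branchInv T b m = fun _ => 0 := funext fun r =>
      le_antisymm ((h.branchInv_mem m r).2.trans_eq hb.symm)
        ((h.b_nonneg _).trans (h.branchInv_mem m r).1)
    exact hconst ▸ concaveOn_const 0 (convex_Ici 0)
  · have hl : ∀ t ∈ Ici (0 : ℝ), b (m + 1) ∈ {x ∈ Ico (b (m + 1)) (b m) | T x ≤ t} :=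
      fun t ht => ⟨h.left_mem hb, (h.map_left hb).trans_le ht⟩
    refine (concaveOn_sSup_sublevel (h.branch m).convexOn bddAbove_Ico (convex_Ici 0)
      fun t ht => ⟨_, hl t ht⟩).congr fun t ht => ?_
    simp only [branchInv, insert_eq_of_mem (hl t ht)]

theorem concaveOn_comp_branchInv (h : IsConvexBranched T b c) (m : ℕ) {G : ℝ → ℝ} {x : ℝ}
    (hG : ConcaveOn ℝ (Icc x (b m)) G) (hmono : Monotone G) {s : Set ℝ} (hs : Convex ℝ s)
    (hs0 : s ⊆ Ici 0) (hsx : ∀ t ∈ s, x ≤ branchInv T b m t) :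
    ConcaveOn ℝ s fun t => G (branchInv T b m t) :=
  ⟨hs, fun u hu t ht _ _ hp hq hpq =>
    (hG.2 ⟨hsx u hu, (h.branchInv_mem m u).2⟩ ⟨hsx t ht, (h.branchInv_mem m t).2⟩ hp hq hpq).trans
      (hmono ((h.concaveOn_branchInv m).2 (hs0 hu) (hs0 ht) hp hq hpq))⟩

theorem hasSum_distFun_map (h : IsConvexBranched T b c) {μ : Measure ℝ} [IsFiniteMeasure μ]
    (hμ : μ ≪ lebI) (t : ℝ) :
    HasSum (fun m => distFun μ (branchInv T b m t) - distFun μ (b (m + 1)))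
      (distFun (μ.map T) t) := by
  have hunion : distFun (μ.map T) t = μ.real (⋃ m, T ⁻¹' Iio t ∩ Ico (b (m + 1)) (b m)) := by
    rw [distFun, map_measureReal_apply h.measurable measurableSet_Iio, ← inter_iUnion]
    refine measureReal_congr ?_
    filter_upwards [hμ.ae_le h.ae_mem_iUnion_branch] with x hx
    exact propext ⟨fun hx' => ⟨hx', hx⟩, fun hx' => hx'.1⟩
  rw [hunion]
  refine (hasSum_measureReal_iUnion (fun i j hij => ?_)
    (fun m => (h.measurable measurableSet_Iio).inter measurableSet_Ico)).congr_fun fun m => ?_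
  · exact (h.anti.pairwise_disjoint_on_Ico_succ hij).mono inter_subset_right inter_subset_right
  · rw [h.preimage_Iio_inter_branch m t, measureReal_Ico μ (h.branchInv_mem m t).1]

theorem concaveOn_distFun_map_of_branches (h : IsConvexBranched T b c) {μ : Measure ℝ}
    [IsFiniteMeasure μ] (hμ : μ ≪ lebI)
    (hc : ∀ m, ConcaveOn ℝ (Icc (b (m + 1)) (b m)) (distFun μ)) :
    ConcaveOn ℝ (Icc 0 1) (distFun (μ.map T)) := by
  refine ⟨convex_Icc 0 1, fun s hs t ht p q hp hq hpq => ?_⟩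
  refine hasSum_le (fun m => ?_)
    (((h.hasSum_distFun_map hμ s).mul_left p).add ((h.hasSum_distFun_map hμ t).mul_left q))
    (h.hasSum_distFun_map hμ _)
  exact ((h.concaveOn_comp_branchInv m (hc m) (distFun_mono μ) (convex_Ici 0) subset_rfl
    fun t _ => (h.branchInv_mem m t).1).add_const (-distFun μ (b (m + 1)))).2 hs.1 ht.1 hp hq hpq

theorem concaveOn_distFun_map (h : IsConvexBranched T b c) {μ : Measure ℝ} [IsFiniteMeasure μ]
    (hμ : μ ≪ lebI) (hc : ConcaveOn ℝ (Icc 0 1) (distFun μ)) :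
    ConcaveOn ℝ (Icc 0 1) (distFun (μ.map T)) :=
  h.concaveOn_distFun_map_of_branches hμ fun _ =>
    hc.subset (Icc_subset_Icc (h.b_nonneg _) (h.b_le_one _)) (convex_Icc _ _)

end IsConvexBranched

theorem isConvexBranched_indicator {g : ℝ → ℝ} {b c : ℕ → ℝ} (b_zero : b 0 = 1)
    (anti : Antitone b) (lim : Tendsto b atTop (𝓝 0)) (strict : ∀ m, 0 < b m → b (m + 1) < b m)
    (mapsTo : MapsTo g (Ioo 0 1) (Icc 0 1))
    (branch : ∀ m, IsConvexBranch g (b (m + 1)) (b m) (c m))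
    (one_lt_last : ∀ m, 0 < b m → b (m + 1) = 0 → 1 < c m) :
    IsConvexBranched ((Ioo (0 : ℝ) 1).indicator g) b c := by
  have hle : ∀ m, b m ≤ 1 := fun m => (anti m.zero_le).trans_eq b_zero
  have heq : ∀ m, EqOn ((Ioo (0 : ℝ) 1).indicator g) g (Ico (b (m + 1)) (b m)) := fun m =>
    (branch m).indicator_Ioo_eqOn (anti.le_of_tendsto lim _) (hle m)
  have hcover : ∀ x ∈ Ioo (0 : ℝ) 1, ∃ m, x ∈ Ico (b (m + 1)) (b m) := fun x hx =>
    exists_mem_Ico_succ_of_tendsto lim hx.1 (b_zero.symm ▸ hx.2)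
  refine ⟨?_, fun x => ?_, b_zero, anti, lim, strict, fun m => (branch m).congr (heq m),
    one_lt_last⟩
  · refine measurable_of_continuousOn_cover (ι := Option ℕ)
      (s := fun i => i.elim (Ioo (0 : ℝ) 1)ᶜ fun m => Ico (b (m + 1)) (b m))
      (Option.rec measurableSet_Ioo.compl fun _ => measurableSet_Ico)
      (eq_univ_of_forall fun x => ?_) (Option.rec ?_ fun m => ?_)
    · by_cases hx : x ∈ Ioo (0 : ℝ) 1
      · exact mem_iUnion.2 ((hcover x hx).imp' some fun _ => id)
      · exact mem_iUnion.2 ⟨none, hx⟩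
    · exact (continuousOn_const (c := (0 : ℝ))).congr fun x hx => indicator_of_notMem hx g
    · exact (branch m).continuousOn.congr (heq m)
  · by_cases hx : x ∈ Ioo (0 : ℝ) 1
    · rw [indicator_of_mem hx]
      refine ⟨(mapsTo hx).1, ?_⟩
      obtain ⟨m, hm⟩ := hcover x hx
      obtain ⟨y, hxy, hy⟩ := exists_between hm.2
      exact ((branch m).strictMonoOn hm ⟨hm.1.trans hxy.le, hy⟩ hxy).trans_le
        (mapsTo ⟨hx.1.trans hxy, hy.trans_le (hle m)⟩).2
    · rw [indicator_of_notMem hx]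
      exact left_mem_Ico.2 zero_lt_one

/-- The slope of the `m`-th branch of `τ` at its left end point. -/
noncomputable def branchSlope (τ : ℝ → ℝ) (a : ℕ → ℝ) (m : ℕ) : ℝ :=
  derivWithin τ (Ioi (a (m + 1))) (a (m + 1))

/-- The partition points of the approximating map `τ_n`: those of `τ` up to index `n`, then `0`. -/
def approxPoints (a : ℕ → ℝ) (n m : ℕ) : ℝ := if m ≤ n then a m else 0

/-- Lower bounds for the slopes of the branches of `τ_n`. The values for `m > n`, where the branch
is empty, are irrelevant. -/
noncomputable def approxSlope (τ : ℝ → ℝ) (a : ℕ → ℝ) (n m : ℕ) : ℝ :=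
  if m = n then 1 / a n else branchSlope τ a m

theorem approxPoints_of_le {a : ℕ → ℝ} {n m : ℕ} (h : m ≤ n) : approxPoints a n m = a m :=
  if_pos h

theorem approxPoints_of_lt {a : ℕ → ℝ} {n m : ℕ} (h : n < m) : approxPoints a n m = 0 :=
  if_neg h.not_ge

theorem le_of_approxPoints_pos {a : ℕ → ℝ} {n m : ℕ} (h : 0 < approxPoints a n m) : m ≤ n := by
  by_contra! hmn
  exact h.ne' (approxPoints_of_lt hmn)

theorem tendsto_approxPoints (a : ℕ → ℝ) (n : ℕ) :
    Tendsto (approxPoints a n) atTop (𝓝 0) := by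
  refine tendsto_const_nhds.congr' ?_
  filter_upwards [eventually_gt_atTop n] with m hm using (approxPoints_of_lt hm).symm

namespace IsPiecewiseConvexZero

variable {τ : ℝ → ℝ} {a : ℕ → ℝ}

theorem a_pos (hτ : IsPiecewiseConvexZero τ a) (m : ℕ) : 0 < a m :=
  (hτ.a_anti.antitone.le_of_tendsto hτ.a_lim (m + 1)).trans_lt (hτ.a_anti m.lt_succ_self)

theorem a_le_one (hτ : IsPiecewiseConvexZero τ a) (m : ℕ) : a m ≤ 1 :=
  (hτ.a_anti.antitone m.zero_le).trans_eq hτ.a_zero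

theorem a_lt_one (hτ : IsPiecewiseConvexZero τ a) {m : ℕ} (hm : 1 ≤ m) : a m < 1 :=
  (hτ.a_anti hm).trans_eq hτ.a_zero

theorem branchSlope_pos (hτ : IsPiecewiseConvexZero τ a) (m : ℕ) : 0 < branchSlope τ a m :=
  hτ.deriv_pos (m + 1) m.succ_pos

theorem branch (hτ : IsPiecewiseConvexZero τ a) (m : ℕ) :
    IsConvexBranch τ (a (m + 1)) (a m) (branchSlope τ a m) where
  slope_pos := hτ.branchSlope_pos m
  continuousOn := hτ.branch_cont m
  convexOn := hτ.branch_convex m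
  map_left _ := hτ.branch_zero (m + 1) m.succ_pos
  slope_le x hx := by
    have hz := hτ.branch_zero (m + 1) m.succ_pos
    rcases hx.1.eq_or_lt with rfl | hlt
    · rw [hz, sub_self, mul_zero]
    · have hd : DifferentiableWithinAt ℝ τ (Ioi (a (m + 1))) (a (m + 1)) := by
        by_contra hd
        exact (hτ.branchSlope_pos m).ne' (derivWithin_zero_of_not_differentiableWithinAt hd)
      have := (hτ.branch_convex m).le_slope_of_hasDerivWithinAt_Ioi
        (left_mem_Ico.2 (hτ.a_anti m.lt_succ_self)) hx hlt hd.hasDerivWithinAt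
      rwa [slope_def_field, hz, sub_zero, le_div_iff₀ (sub_pos.2 hlt)] at this

theorem isConvexBranched (hτ : IsPiecewiseConvexZero τ a) :
    IsConvexBranched ((Ioo (0 : ℝ) 1).indicator τ) a (branchSlope τ a) :=
  isConvexBranched_indicator hτ.a_zero hτ.a_anti.antitone hτ.a_lim
    (fun m _ => hτ.a_anti m.lt_succ_self) (hτ.mapsTo.mono_left Ioo_subset_Icc_self)
    hτ.branch fun m _ h0 => absurd h0 (hτ.a_pos (m + 1)).ne'

theorem tendsto_branchSlope (hτ : IsPiecewiseConvexZero τ a) :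
    Tendsto (branchSlope τ a) atTop atTop := by
  refine (tendsto_inv_nhdsGT_zero.comp (tendsto_nhdsWithin_iff.2
    ⟨hτ.summable_inv_deriv.tendsto_atTop_zero, Eventually.of_forall fun m =>
      one_div_pos.2 (hτ.branchSlope_pos m)⟩)).congr fun m => ?_
  simp only [Function.comp_apply, one_div, inv_inv, branchSlope]

theorem approxMap_eqOn_branch (hτ : IsPiecewiseConvexZero τ a) {n m : ℕ} (hm : m < n) :
    EqOn (approxMap τ a n) τ (Ico (a (m + 1)) (a m)) := fun _ hx =>
  if_neg ((hτ.a_anti.antitone hm).trans hx.1).not_gt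

theorem antitone_approxPoints (hτ : IsPiecewiseConvexZero τ a) (n : ℕ) :
    Antitone (approxPoints a n) := by
  refine antitone_nat_of_succ_le fun m => ?_
  rcases lt_or_ge m n with hm | hm
  · rw [approxPoints_of_le hm, approxPoints_of_le hm.le]
    exact hτ.a_anti.antitone m.le_succ
  · rw [approxPoints_of_lt (Nat.lt_succ_of_le hm), approxPoints]
    split_ifs
    exacts [(hτ.a_pos m).le, le_rfl]

theorem approxPoints_succ_lt (hτ : IsPiecewiseConvexZero τ a) {n m : ℕ}
    (h : 0 < approxPoints a n m) : approxPoints a n (m + 1) < approxPoints a n m := by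
  rcases (le_of_approxPoints_pos h).lt_or_eq with hm | rfl
  · rw [approxPoints_of_le hm, approxPoints_of_le hm.le]
    exact hτ.a_anti m.lt_succ_self
  · rwa [approxPoints_of_lt m.lt_succ_self]

theorem approxMap_mapsTo (hτ : IsPiecewiseConvexZero τ a) (n : ℕ) :
    MapsTo (approxMap τ a n) (Ioo 0 1) (Icc 0 1) := by
  intro x hx
  unfold approxMap
  split_ifs with hlt
  · exact ⟨div_nonneg hx.1.le (hτ.a_pos n).le, (div_le_one (hτ.a_pos n)).2 hlt.le⟩
  · exact hτ.mapsTo (Ioo_subset_Icc_self hx)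

theorem approxMap_branch (hτ : IsPiecewiseConvexZero τ a) (n m : ℕ) :
    IsConvexBranch (approxMap τ a n) (approxPoints a n (m + 1)) (approxPoints a n m)
      (approxSlope τ a n m) := by
  rcases lt_trichotomy m n with hm | rfl | hm
  · rw [approxPoints_of_le hm, approxPoints_of_le hm.le, approxSlope, if_neg hm.ne]
    exact (hτ.branch m).congr (hτ.approxMap_eqOn_branch hm)
  · rw [approxPoints_of_lt m.lt_succ_self, approxPoints_of_le le_rfl, approxSlope, if_pos rfl]
    refine (isConvexBranch_mul (one_div_pos.2 (hτ.a_pos m)) (a m)).congr fun x hx => ?_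
    simp only [approxMap, if_pos hx.2, one_div_mul_eq_div]
  · rw [approxPoints_of_lt hm, approxPoints_of_lt (hm.trans m.lt_succ_self), approxSlope,
      if_neg hm.ne']
    exact isConvexBranch_empty _ 0 (hτ.branchSlope_pos m)

theorem approx_isConvexBranched (hτ : IsPiecewiseConvexZero τ a) {n : ℕ} (hn : 1 ≤ n) :
    IsConvexBranched ((Ioo (0 : ℝ) 1).indicator (approxMap τ a n)) (approxPoints a n)
      (approxSlope τ a n) := by
  refine isConvexBranched_indicator ((approxPoints_of_le n.zero_le).trans hτ.a_zero)
    (hτ.antitone_approxPoints n) (tendsto_approxPoints a n) (fun m => hτ.approxPoints_succ_lt)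
    (hτ.approxMap_mapsTo n) (hτ.approxMap_branch n) fun m hpos hzero => ?_
  obtain hm | rfl := (le_of_approxPoints_pos hpos).lt_or_eq
  · rw [approxPoints_of_le hm] at hzero
    exact absurd hzero (hτ.a_pos _).ne'
  · rw [approxSlope, if_pos rfl]
    exact (one_lt_div (hτ.a_pos m)).2 (hτ.a_lt_one hn)

end IsPiecewiseConvexZero

section Cells

variable {k : ℕ}

theorem natCast_pos_of_fin (i : Fin k) : (0 : ℝ) < k := Nat.cast_pos.2 i.pos

theorem cell_left_nonneg (i : Fin k) : (0 : ℝ) ≤ (i : ℝ) / k := by positivity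

theorem cell_left_lt_right (i : Fin k) : (i : ℝ) / k < ((i : ℝ) + 1) / k :=
  div_lt_div_of_pos_right (lt_add_one _) (natCast_pos_of_fin i)

theorem zero_mem_cell (hk : 0 < k) : (0 : ℝ) ∈ cell k ⟨0, hk⟩ := by
  simp [cell, hk]

theorem cell_right_le_one (i : Fin k) : ((i : ℝ) + 1) / k ≤ 1 := by
  rw [div_le_one (natCast_pos_of_fin i)]
  exact_mod_cast i.isLt

theorem measurableSet_cell (i : Fin k) : MeasurableSet (cell k i) := measurableSet_Ico

theorem lebI_real_cell (i : Fin k) : lebI.real (cell k i) = 1 / k := by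
  rw [cell, lebI_real_Ico (cell_left_nonneg i) (cell_left_lt_right i).le (cell_right_le_one i)]
  ring

theorem cell_subset (i : Fin k) : cell k i ⊆ Ico 0 1 :=
  Ico_subset_Ico (cell_left_nonneg i) (cell_right_le_one i)

theorem le_of_mem_cell {i j : Fin k} {x y : ℝ} (hx : x ∈ cell k i) (hy : y ∈ cell k j)
    (hxy : x ≤ y) : i ≤ j := by
  have hij : (i : ℝ) / k < ((j : ℝ) + 1) / k := hx.1.trans_lt (hxy.trans_lt hy.2)
  rw [div_lt_div_iff_of_pos_right (natCast_pos_of_fin i)] at hij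
  exact Nat.lt_succ_iff.1 (by exact_mod_cast hij)

theorem eq_of_mem_cell {i j : Fin k} {x : ℝ} (hi : x ∈ cell k i) (hj : x ∈ cell k j) : i = j :=
  le_antisymm (le_of_mem_cell hi hj le_rfl) (le_of_mem_cell hj hi le_rfl)

theorem exists_mem_cell (hk : 1 ≤ k) {x : ℝ} (hx : x ∈ Ico (0 : ℝ) 1) :
    ∃ i, x ∈ cell k i := by
  have hk0 : (0 : ℝ) < k := Nat.cast_pos.2 hk
  have hxk : 0 ≤ x * k := mul_nonneg hx.1 hk0.le
  refine ⟨⟨⌊x * k⌋₊, (Nat.floor_lt hxk).2 (mul_lt_of_lt_one_left hk0 hx.2)⟩, ?_, ?_⟩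
  · exact (div_le_iff₀ hk0).2 (Nat.floor_le hxk)
  · exact (lt_div_iff₀ hk0).2 (Nat.lt_floor_add_one _)

theorem iUnion_cell (hk : 1 ≤ k) : ⋃ i, cell k i = Ico (0 : ℝ) 1 :=
  Subset.antisymm (iUnion_subset cell_subset) fun _ hx => mem_iUnion.2 (exists_mem_cell hk hx)

theorem pairwise_disjoint_cell : Pairwise (Function.onFun Disjoint (cell k)) := fun _ _ hij =>
  Set.disjoint_left.2 fun _ hi hj => hij (eq_of_mem_cell hi hj)

theorem stepFn_of_mem (v : Fin k → ℝ) {i : Fin k} {x : ℝ} (hx : x ∈ cell k i) :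
    stepFn k v x = v i := by
  rw [stepFn, Finset.sum_eq_single i]
  · exact indicator_of_mem hx _
  · exact fun j _ hj => indicator_of_notMem (fun h => hj (eq_of_mem_cell h hx)) _
  · exact fun h => absurd (Finset.mem_univ i) h

theorem stepFn_of_notMem (v : Fin k → ℝ) {x : ℝ} (hx : x ∉ Ico (0 : ℝ) 1) : stepFn k v x = 0 :=
  Finset.sum_eq_zero fun i _ => indicator_of_notMem (fun h => hx (cell_subset i h)) _

theorem stepFn_nonneg {v : Fin k → ℝ} (hv : ∀ i, 0 ≤ v i) (x : ℝ) : 0 ≤ stepFn k v x :=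
  Finset.sum_nonneg fun i _ => indicator_nonneg (fun _ _ => hv i) x

theorem stepFn_le {v : Fin k → ℝ} {C : ℝ} (hC : 0 ≤ C) (hv : ∀ i, v i ≤ C) (x : ℝ) :
    stepFn k v x ≤ C := by
  by_cases hx : ∃ i, x ∈ cell k i
  · obtain ⟨i, hi⟩ := hx
    exact (stepFn_of_mem v hi).trans_le (hv i)
  · exact (Finset.sum_eq_zero fun i _ =>
      indicator_of_notMem (fun h => hx ⟨i, h⟩) _).trans_le hC

theorem antitoneOn_stepFn {v : Fin k → ℝ} (hv : ∀ i, 0 ≤ v i) (ha : Antitone v) :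
    AntitoneOn (stepFn k v) (Ici 0) := by
  intro x hx y _ hxy
  by_cases hcell : ∃ j, y ∈ cell k j
  · obtain ⟨j, hj⟩ := hcell
    obtain ⟨i, hi⟩ := exists_mem_cell j.pos ⟨hx, hxy.trans_lt (cell_subset j hj).2⟩
    rw [stepFn_of_mem v hi, stepFn_of_mem v hj]
    exact ha (le_of_mem_cell hi hj hxy)
  · rw [show stepFn k v y = 0 from Finset.sum_eq_zero fun j _ =>
      indicator_of_notMem (fun h => hcell ⟨j, h⟩) _]
    exact stepFn_nonneg hv x

theorem integrable_stepFn (k : ℕ) (v : Fin k → ℝ) : Integrable (stepFn k v) lebI :=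
  memLp_one_iff_integrable.1 (memLp_stepFn k v)

theorem setIntegral_stepFn (v : Fin k → ℝ) (A : Set ℝ) :
    ∫ x in A, stepFn k v x ∂lebI = ∑ i, v i * lebI.real (A ∩ cell k i) := by
  unfold stepFn
  rw [integral_finsetSum _ fun i _ =>
    ((integrable_const (v i)).indicator (measurableSet_cell i)).integrableOn]
  refine Finset.sum_congr rfl fun i _ => ?_
  rw [integral_indicator (measurableSet_cell i), setIntegral_const, smul_eq_mul, mul_comm,
    measureReal_restrict_apply (measurableSet_cell i), inter_comm]

instance isFiniteMeasure_densityMeasure_stepFn (v : Fin k → ℝ) :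
    IsFiniteMeasure (densityMeasure (stepFn k v)) :=
  isFiniteMeasure_densityMeasure (integrable_stepFn k v)

theorem densityMeasure_stepFn_real {v : Fin k → ℝ} (hv : ∀ i, 0 ≤ v i) {A : Set ℝ}
    (hA : MeasurableSet A) :
    (densityMeasure (stepFn k v)).real A = ∑ i, v i * lebI.real (A ∩ cell k i) := by
  rw [densityMeasure_real (integrable_stepFn k v) (ae_of_all _ (stepFn_nonneg hv)) hA,
    setIntegral_stepFn]

theorem densityMeasure_stepFn_Ico_le {v : Fin k → ℝ} (hv : ∀ i, 0 ≤ v i) {C x y : ℝ}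
    (hC : ∀ z ∈ Ico x y, stepFn k v z ≤ C) (hx : 0 ≤ x) (hxy : x ≤ y) (hy : y ≤ 1) :
    (densityMeasure (stepFn k v)).real (Ico x y) ≤ C * (y - x) :=
  densityMeasure_Ico_le (integrable_stepFn k v) (ae_of_all _ (stepFn_nonneg hv)) hC hx hxy hy

theorem le_densityMeasure_stepFn_Ico {v : Fin k → ℝ} (hv : ∀ i, 0 ≤ v i) {c x y : ℝ}
    (hc : ∀ z ∈ Ico x y, c ≤ stepFn k v z) (hx : 0 ≤ x) (hxy : x ≤ y) (hy : y ≤ 1) :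
    c * (y - x) ≤ (densityMeasure (stepFn k v)).real (Ico x y) :=
  le_densityMeasure_Ico (integrable_stepFn k v) (ae_of_all _ (stepFn_nonneg hv)) hc hx hxy hy

theorem concaveOn_distFun_stepFn {v : Fin k → ℝ} (hv : ∀ i, 0 ≤ v i) (ha : Antitone v) :
    ConcaveOn ℝ (Icc 0 1) (distFun (densityMeasure (stepFn k v))) :=
  concaveOn_distFun_of_antitoneOn (integrable_stepFn k v) (ae_of_all _ (stepFn_nonneg hv))
    ((antitoneOn_stepFn hv ha).mono Icc_subset_Ici_self)

theorem integral_stepFn (v : Fin k → ℝ) : ∫ x, stepFn k v x ∂lebI = (∑ i, v i) / k := by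
  rw [← setIntegral_univ, setIntegral_stepFn, Finset.sum_div]
  refine Finset.sum_congr rfl fun i _ => ?_
  rw [univ_inter, lebI_real_cell, mul_one_div]

theorem stepL1_ae_eq (k : ℕ) (v : Fin k → ℝ) : stepL1 k v =ᵐ[lebI] stepFn k v :=
  (memLp_stepFn k v).coeFn_toLp

theorem norm_stepL1 {v : Fin k → ℝ} (hv : ∀ i, 0 ≤ v i) : ‖stepL1 k v‖ = (∑ i, v i) / k := by
  rw [L1.norm_eq_integral_norm, ← integral_stepFn]
  refine integral_congr_ae ?_
  filter_upwards [stepL1_ae_eq k v] with x hx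
  rw [hx, Real.norm_of_nonneg (stepFn_nonneg hv x)]

end Cells

theorem exists_fixedPoint_of_isCompact_convex {E : Type*} [NormedAddCommGroup E]
    [NormedSpace ℝ E] (L : E →L[ℝ] E) {S : Set E} (hc : IsCompact S) (hconv : Convex ℝ S)
    (hne : S.Nonempty) (hL : MapsTo L S S) : ∃ x ∈ S, L x = x := by
  obtain ⟨x₀, hx₀⟩ := hne
  have horbit (j : ℕ) : L^[j] x₀ ∈ S := hL.iterate j hx₀
  set y : ℕ → E := fun N => birkhoffAverage ℝ L id (N + 1) x₀
  have hyS (N : ℕ) : y N ∈ S := by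
    simp only [y, birkhoffAverage, birkhoffSum, Finset.smul_sum]
    refine hconv.sum_mem (fun _ _ => by positivity) ?_ fun j _ => horbit j
    rw [Finset.sum_const, Finset.card_range, nsmul_eq_mul,
      mul_inv_cancel₀ (Nat.cast_ne_zero.2 N.succ_ne_zero)]
  have hLy (N : ℕ) : L (y N) = birkhoffAverage ℝ L id (N + 1) (L x₀) := by
    rw [map_birkhoffAverage ℝ ℝ L]
    simp only [birkhoffAverage, birkhoffSum, Function.comp_apply, id_eq,
      ← Function.iterate_succ_apply', Function.iterate_succ_apply]
  have hlim : Tendsto (fun N => L (y N) - y N) atTop (𝓝 0) := by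
    simp only [hLy]
    exact (tendsto_birkhoffAverage_apply_sub_birkhoffAverage ℝ
      (hc.isBounded.subset (range_subset_iff.2 horbit))).comp (tendsto_add_atTop_nat 1)
  obtain ⟨x, hxS, φ, hφ, hyx⟩ := hc.tendsto_subseq hyS
  refine ⟨x, hxS, sub_eq_zero.1 (tendsto_nhds_unique ?_ (hlim.comp hφ.tendsto_atTop))⟩
  exact ((L.continuous.tendsto x).comp hyx).sub hyx

section Ulam

variable {T : ℝ → ℝ} {k : ℕ}

theorem ulamMatrix_congr {T' : ℝ → ℝ} (h : T =ᵐ[lebI] T') (k : ℕ) :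
    ulamMatrix T k = ulamMatrix T' k := by
  ext i j
  simp only [ulamMatrix, Matrix.of_apply]
  congr 1
  refine measureReal_congr ?_
  filter_upwards [h] with x hx
  exact propext (and_congr_left fun _ => by simp only [mem_preimage, hx])

theorem isUlamDensity_congr {T' : ℝ → ℝ} (h : T =ᵐ[lebI] T') (v : Fin k → ℝ) :
    IsUlamDensity T k v ↔ IsUlamDensity T' k v := by
  simp only [IsUlamDensity, ulamOp, ulamMatrix_congr h]

theorem ulamMatrix_nonneg (T : ℝ → ℝ) (i j : Fin k) : 0 ≤ ulamMatrix T k i j :=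
  div_nonneg measureReal_nonneg measureReal_nonneg

theorem ulamMatrix_row_sum (hm : Measurable T) (hT : ∀ x, T x ∈ Ico (0 : ℝ) 1) (i : Fin k) :
    ∑ j, ulamMatrix T k i j = 1 := by
  simp only [ulamMatrix, Matrix.of_apply]
  rw [← Finset.sum_div, ← measureReal_iUnion_fintype
    (fun j l hjl => ((pairwise_disjoint_cell hjl).preimage T).mono inter_subset_left
      inter_subset_left)
    (fun j => (hm (measurableSet_cell j)).inter (measurableSet_cell i)), ← iUnion_inter,
    ← preimage_iUnion, iUnion_cell i.pos, preimage_eq_univ_iff.2 (range_subset_iff.2 hT),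
    univ_inter, div_self]
  rw [lebI_real_cell]
  exact one_div_ne_zero (natCast_pos_of_fin i).ne'

theorem ulamOp_smul (r : ℝ) (v : Fin k → ℝ) : ulamOp T k (r • v) = r • ulamOp T k v :=
  Matrix.smul_vecMul _ _ _

theorem ulamOp_apply (hm : Measurable T) {v : Fin k → ℝ} (hv : ∀ i, 0 ≤ v i) (j : Fin k) :
    ulamOp T k v j = k * (densityMeasure (stepFn k v)).real (T ⁻¹' cell k j) := by
  rw [densityMeasure_stepFn_real hv (hm (measurableSet_cell j)), ulamOp, Matrix.vecMul,
    dotProduct, Finset.mul_sum]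
  refine Finset.sum_congr rfl fun i _ => ?_
  rw [ulamMatrix, Matrix.of_apply, lebI_real_cell, one_div, div_inv_eq_mul]
  ring

theorem mul_ulamMatrix_le_ulamOp {v : Fin k → ℝ} (hv : ∀ i, 0 ≤ v i) (i j : Fin k) :
    v i * ulamMatrix T k i j ≤ ulamOp T k v j :=
  Finset.single_le_sum (f := fun i => v i * ulamMatrix T k i j)
    (fun l _ => mul_nonneg (hv l) (ulamMatrix_nonneg T l j)) (Finset.mem_univ i)

theorem ulamOp_nonneg {v : Fin k → ℝ} (hv : ∀ i, 0 ≤ v i) (j : Fin k) : 0 ≤ ulamOp T k v j := by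
  simp only [ulamOp, Matrix.vecMul, dotProduct]
  exact Finset.sum_nonneg fun i _ => mul_nonneg (hv i) (ulamMatrix_nonneg T i j)

theorem sum_ulamOp (hm : Measurable T) (hT : ∀ x, T x ∈ Ico (0 : ℝ) 1) (v : Fin k → ℝ) :
    ∑ j, ulamOp T k v j = ∑ i, v i := by
  simp only [ulamOp, Matrix.vecMul, dotProduct]
  rw [Finset.sum_comm]
  simp only [← Finset.mul_sum, ulamMatrix_row_sum hm hT, mul_one]

theorem antitone_measureReal_cell {μ : Measure ℝ} [IsFiniteMeasure μ]
    (hμ : ConcaveOn ℝ (Icc 0 1) (distFun μ)) : Antitone fun i => μ.real (cell k i) := by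
  cases k with
  | zero => exact fun i => i.elim0
  | succ k =>
    refine Fin.antitone_iff_succ_le.2 fun i => ?_
    have hcell (j : Fin (k + 1)) := cell_left_lt_right j
    have hsucc : ((i.succ : Fin (k + 1)) : ℝ) = (i.castSucc : Fin (k + 1)) + 1 := by simp
    have hlt := hcell i.succ
    have hright := cell_right_le_one i.succ
    rw [cell, cell, measureReal_Ico μ (hcell _).le, measureReal_Ico μ (hcell _).le]
    rw [hsucc] at hlt hright ⊢
    have hslope := hμ.slope_anti_adjacent
      ⟨cell_left_nonneg i.castSucc, (hcell i.castSucc).le.trans (hlt.le.trans hright)⟩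
      ⟨(cell_left_nonneg i.castSucc).trans ((hcell i.castSucc).trans hlt).le, hright⟩
      (hcell i.castSucc) hlt
    rwa [← sub_div, ← sub_div, add_sub_cancel_left, add_sub_cancel_left,
      div_le_div_iff_of_pos_right (by positivity)] at hslope

namespace IsConvexBranched

variable {b c : ℕ → ℝ}

theorem antitone_ulamOp (h : IsConvexBranched T b c) {v : Fin k → ℝ} (hv : ∀ i, 0 ≤ v i)
    (ha : Antitone v) : Antitone (ulamOp T k v) := by
  have hcell := antitone_measureReal_cell (k := k)
    (h.concaveOn_distFun_map (densityMeasure_ac _) (concaveOn_distFun_stepFn hv ha))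
  intro i j hij
  rw [ulamOp_apply h.measurable hv, ulamOp_apply h.measurable hv,
    ← map_measureReal_apply h.measurable (measurableSet_cell i),
    ← map_measureReal_apply h.measurable (measurableSet_cell j)]
  exact mul_le_mul_of_nonneg_left (hcell hij) k.cast_nonneg

theorem exists_antitone_ulamDensity (h : IsConvexBranched T b c) (hk : 1 ≤ k) :
    ∃ v : Fin k → ℝ, IsUlamDensity T k v ∧ Antitone v := by
  have hk0 : (k : ℝ) ≠ 0 := Nat.cast_ne_zero.2 (Nat.one_le_iff_ne_zero.1 hk)
  have hconv : Convex ℝ {v : Fin k → ℝ | Antitone v} :=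
    fun u hu w hw p q hp hq _ => (hu.const_smul hp).add (hw.const_smul hq)
  obtain ⟨w, ⟨⟨hw0, hw1⟩, hwa⟩, hfix⟩ := exists_fixedPoint_of_isCompact_convex
    (ulamMatrix T k).vecMulLinear.toContinuousLinearMap
    ((isCompact_stdSimplex ℝ (Fin k)).inter_right isClosed_antitone)
    ((convex_stdSimplex ℝ (Fin k)).inter hconv)
    ⟨fun _ => (k : ℝ)⁻¹, ⟨fun _ => by positivity, by simp [hk0]⟩, antitone_const⟩
    fun v ⟨⟨hv0, hv1⟩, hva⟩ => ⟨⟨ulamOp_nonneg hv0,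
      (sum_ulamOp h.measurable h.mapsTo v).trans hv1⟩, h.antitone_ulamOp hv0 hva⟩
  have hkw (i : Fin k) : 0 ≤ ((k : ℝ) • w) i := mul_nonneg k.cast_nonneg (hw0 i)
  refine ⟨(k : ℝ) • w, ⟨hkw, ?_, ?_⟩,
    fun _ _ hij => mul_le_mul_of_nonneg_left (hwa hij) k.cast_nonneg⟩
  · exact (ulamOp_smul (k : ℝ) w).trans (congrArg ((k : ℝ) • ·) hfix)
  · simp only [norm_stepL1 hkw, Pi.smul_apply, smul_eq_mul, ← Finset.mul_sum, hw1, mul_one,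
      div_self hk0]

theorem ulamMatrix_pos (h : IsConvexBranched T b c) {m : ℕ} {x : ℝ}
    (hx : x ∈ Ico (b (m + 1)) (b m)) {i j : Fin k} (hi : x ∈ cell k i) (hj : T x ∈ cell k j) :
    0 < ulamMatrix T k i j := by
  have hcell : ∀ᶠ y in 𝓝[≥] x, y ∈ T ⁻¹' cell k j ∩ cell k i := by
    have hbranch : ∀ᶠ y in 𝓝[≥] x, y ∈ Ico x (b m) := Ico_mem_nhdsGE hx.2
    have hcont : ContinuousWithinAt T (Ici x) x :=
      (((h.branch m).continuousOn x hx).mono (Ico_subset_Ico_left hx.1)).mono_of_mem_nhdsWithin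
        hbranch
    filter_upwards [hbranch, hcont (gt_mem_nhds hj.2), Ico_mem_nhdsGE hi.2]
      with y hy hyT hyi
    refine ⟨⟨hj.1.trans ?_, hyT⟩, hi.1.trans hy.1, hyi.2⟩
    exact (h.branch m).strictMonoOn.monotoneOn hx ⟨hx.1.trans hy.1, hy.2⟩ hy.1
  obtain ⟨w, hw, hsub⟩ := (mem_nhdsGE_iff_exists_Ico_subset' (cell_subset i hi).2).1
    (hcell.and (Ico_mem_nhdsGE (cell_subset i hi).2))
  have hxw : lebI.real (Ico x (min w 1)) = min w 1 - x :=
    lebI_real_Ico (cell_subset i hi).1 (le_min hw.le (cell_subset i hi).2.le) (min_le_right _ _)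
  refine div_pos ?_ (by rw [lebI_real_cell]; exact one_div_pos.2 (natCast_pos_of_fin i))
  calc 0 < lebI.real (Ico x (min w 1)) :=
        hxw ▸ sub_pos.2 (lt_min hw (cell_subset i hi).2)
    _ ≤ lebI.real (T ⁻¹' cell k j ∩ cell k i) :=
        measureReal_mono fun y hy => (hsub ⟨hy.1, hy.2.trans_le (min_le_left _ _)⟩).1

theorem mapsTo_support_stepFn (h : IsConvexBranched T b c) {v : Fin k → ℝ} (hv : ∀ i, 0 ≤ v i)
    (hfix : ulamOp T k v = v) :
    MapsTo T (Function.support (stepFn k v) ∩ Ioo 0 1) (Function.support (stepFn k v)) := by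
  rintro x ⟨hxv, hx⟩
  obtain ⟨m, hm⟩ := h.exists_branch hx
  obtain ⟨i, hi⟩ : ∃ i, x ∈ cell k i := by
    by_contra! hnot
    exact hxv (Finset.sum_eq_zero fun i _ => indicator_of_notMem (hnot i) _)
  obtain ⟨j, hj⟩ := exists_mem_cell i.pos (h.mapsTo x)
  rw [Function.mem_support, stepFn_of_mem v hi] at hxv
  rw [Function.mem_support, stepFn_of_mem v hj, ← hfix]
  exact ((mul_pos ((hv i).lt_of_ne' hxv) (h.ulamMatrix_pos hm hi hj)).trans_le
    (mul_ulamMatrix_le_ulamOp hv i j)).ne'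

end IsConvexBranched

end Ulam

section Uniqueness

variable {T : ℝ → ℝ} {k : ℕ} {b c : ℕ → ℝ} {v : Fin k → ℝ}

theorem exists_grid_superset {x y : ℝ} (hxy : x < y)
    (hS : Ico x y ⊆ Function.support (stepFn k v)) :
    ∃ p q : ℕ, q ≤ k ∧ (p : ℝ) / k ≤ x ∧ y ≤ q / k ∧
      Ico ((p : ℝ) / k) (q / k) ⊆ Function.support (stepFn k v) := by
  have hsub : Ico x y ⊆ Ico 0 1 := fun z hz => by_contra fun h => hS hz (stepFn_of_notMem v h)
  obtain ⟨hx0, hy1⟩ := (Ico_subset_Ico_iff hxy).1 hsub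
  rcases k.eq_zero_or_pos with rfl | hk
  · exact absurd (by simp [stepFn]) (hS (left_mem_Ico.2 hxy))
  have hk0 : (0 : ℝ) < k := Nat.cast_pos.2 hk
  have hqk : ⌈y * k⌉₊ ≤ k := Nat.ceil_le.2 (mul_le_of_le_one_left hk0.le hy1)
  refine ⟨⌊x * k⌋₊, ⌈y * k⌉₊, hqk, ?_, ?_, fun z hz => ?_⟩
  · exact (div_le_iff₀ hk0).2 (Nat.floor_le (mul_nonneg hx0 hk0.le))
  · exact (le_div_iff₀ hk0).2 (Nat.le_ceil _)
  have hz1 : z < 1 := hz.2.trans_le ((div_le_one hk0).2 (Nat.cast_le.2 hqk))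
  obtain ⟨j, hj⟩ := exists_mem_cell hk ⟨(by positivity : (0 : ℝ) ≤ _).trans hz.1, hz1⟩
  have hxj : x < ((j : ℝ) + 1) / k := by
    have hpj : (⌊x * k⌋₊ : ℝ) / k < ((j : ℝ) + 1) / k := hz.1.trans_lt hj.2
    rw [div_lt_div_iff_of_pos_right hk0] at hpj
    rw [lt_div_iff₀ hk0]
    exact_mod_cast (Nat.floor_lt' (j : ℕ).succ_ne_zero).1 (by exact_mod_cast hpj)
  have hjy : (j : ℝ) / k < y := by
    have hjq : (j : ℝ) / k < ⌈y * k⌉₊ / k := hj.1.trans_lt hz.2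
    rw [div_lt_div_iff_of_pos_right hk0, Nat.cast_lt] at hjq
    exact (div_lt_iff₀ hk0).2 (Nat.lt_ceil.1 hjq)
  have hmax : max x ((j : ℝ) / k) ∈ cell k j :=
    ⟨le_max_right _ _, max_lt hxj (cell_left_lt_right j)⟩
  rw [Function.mem_support, stepFn_of_mem v hj, ← stepFn_of_mem v hmax]
  exact hS ⟨le_max_left _ _, max_lt hxy hjy⟩

namespace IsConvexBranched

theorem exists_branch_superset (h : IsConvexBranched T b c) {x y : ℝ} (hxy : x < y) (hx : 0 < x)
    (hy : y ≤ 1) (hb : ∀ m, 0 < b m → b (m + 1) ∉ Ico x y) :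
    ∃ m, b (m + 1) < x ∧ y ≤ b m := by
  obtain ⟨m, hm⟩ := h.exists_branch ⟨hx, hxy.trans_le hy⟩
  have hbm := h.b_pos_of_mem hm
  refine ⟨m, hm.1.lt_of_ne fun he => hb m hbm ⟨he.ge, he.trans_lt hxy⟩, not_lt.1 fun hlt => ?_⟩
  cases m with
  | zero => exact (h.b_zero ▸ hlt).not_ge hy
  | succ m => exact hb m (hbm.trans_le (h.b_succ_le m)) ⟨hm.2.le, hlt⟩

theorem exists_longer_support (h : IsConvexBranched T b c) (hv : ∀ i, 0 ≤ v i)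
    (hfix : ulamOp T k v = v) (h0 : stepFn k v 0 = 0) {x y : ℝ} (hxy : x < y)
    (hS : Ico x y ⊆ Function.support (stepFn k v)) :
    ∃ x' y', x' < y' ∧ Ico x' y' ⊆ Function.support (stepFn k v) ∧
      toLex (y / x, y) < toLex (y' / x', y') := by
  have hT := h.mapsTo_support_stepFn hv hfix
  have hsub : Ico x y ⊆ Ioo 0 1 := fun z hz =>
    have hz1 : z ∈ Ico (0 : ℝ) 1 := by_contra fun hz1 => hS hz (stepFn_of_notMem v hz1)
    ⟨hz1.1.lt_of_ne fun he => hS hz (he ▸ h0), hz1.2⟩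
  have hx : 0 < x := (hsub (left_mem_Ico.2 hxy)).1
  have hy : y ≤ 1 := ((Ico_subset_Ico_iff hxy).1 (hsub.trans Ioo_subset_Ico_self)).2
  obtain ⟨m, hlx, hyr⟩ := h.exists_branch_superset hxy hx hy fun m hm hmem => by
    have hTb := hT ⟨hS hmem, hsub hmem⟩
    rw [h.map_left hm] at hTb
    exact hTb h0
  have hxm : x ∈ Ico (b (m + 1)) (b m) := ⟨hlx.le, hxy.trans_le hyr⟩
  have hbm := h.b_pos_of_mem hxm
  have hslope := (h.branch m).mul_sub_le (h.left_mem hbm) hxm hlx.le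
  rw [h.map_left hbm, sub_zero] at hslope
  set l := b (m + 1) with hl
  have hxl : 0 < x - l := sub_pos.2 hlx
  have hTx : 0 < T x := (mul_pos (h.branch m).slope_pos hxl).trans_le hslope
  refine ⟨T x, T x * ((y - l) / (x - l)), ?_, ?_, ?_⟩
  · exact lt_mul_of_one_lt_right hTx ((one_lt_div hxl).2 (sub_lt_sub_right hxy l))
  · refine ((h.branch m).Ico_subset_image hlx hxy hyr).trans (image_subset_iff.2 fun z hz => ?_)
    exact hT ⟨hS hz, hsub hz⟩
  · rw [mul_div_cancel_left₀ _ hTx.ne', Prod.Lex.toLex_lt_toLex]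
    rcases (h.b_nonneg (m + 1)).eq_or_lt' with hl0 | hl0
    · have hc := h.one_lt_last m hbm hl0
      rw [hl, hl0, sub_zero] at hslope ⊢
      rw [sub_zero]
      refine Or.inr ⟨rfl, ?_⟩
      rw [← mul_div_assoc, lt_div_iff₀ hx, mul_comm (T x)]
      exact mul_lt_mul_of_pos_left ((lt_mul_of_one_lt_left hx hc).trans_le hslope) (hx.trans hxy)
    · refine Or.inl ((div_lt_div_iff₀ hx hxl).2 ?_)
      nlinarith [mul_lt_mul_of_pos_right hxy hl0]

theorem eq_zero_of_fixed (h : IsConvexBranched T b c) (hv : ∀ i, 0 ≤ v i)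
    (hfix : ulamOp T k v = v) (h0 : stepFn k v 0 = 0) : v = 0 := by
  classical
  by_contra hne
  obtain ⟨i, hi⟩ := Function.ne_iff.1 hne
  set Q : Finset (ℕ × ℕ) := (Finset.range (k + 1) ×ˢ Finset.range (k + 1)).filter fun r =>
    (r.1 : ℝ) / k < r.2 / k ∧ Ico ((r.1 : ℝ) / k) (r.2 / k) ⊆ Function.support (stepFn k v)
  have hQ : Q.Nonempty := by
    refine ⟨(i, i + 1), ?_⟩
    simp only [Q, Finset.mem_filter, Finset.mem_product, Finset.mem_range]
    refine ⟨by omega, by exact_mod_cast cell_left_lt_right i, fun x hx => ?_⟩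
    rwa [Function.mem_support, stepFn_of_mem v (i := i) (by simpa [cell] using hx)]
  obtain ⟨⟨p, q⟩, hpq, hmax⟩ := Q.exists_max_image
    (fun r => toLex ((r.2 : ℝ) / k / (r.1 / k), (r.2 : ℝ) / k)) hQ
  obtain ⟨-, hlt, hS⟩ := Finset.mem_filter.1 hpq
  obtain ⟨x, y, hxy, hxyS, hlex⟩ := h.exists_longer_support hv hfix h0 hlt hS
  obtain ⟨p', q', hq', hp'x, hyq', hS'⟩ := exists_grid_superset hxy hxyS
  have hlt' := hp'x.trans_lt (hxy.trans_le hyq')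
  have hp' : (0 : ℝ) < p' / k := (by positivity : (0 : ℝ) ≤ p' / k).lt_of_ne fun he =>
    hS' (left_mem_Ico.2 hlt') (he ▸ h0)
  have hp'q' : p' < q' := by
    rw [div_lt_div_iff_of_pos_right (natCast_pos_of_fin i)] at hlt'
    exact_mod_cast hlt'
  refine (hlex.trans_le ?_).not_ge (hmax (p', q') ?_)
  · have hle : y / x ≤ (q' : ℝ) / k / (p' / k) :=
      div_le_div₀ (by positivity) hyq' hp' hp'x
    exact Prod.Lex.toLex_mono ⟨hle, hyq'⟩
  · simp only [Q, Finset.mem_filter, Finset.mem_product, Finset.mem_range]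
    exact ⟨by omega, hlt', hS'⟩

end IsConvexBranched

theorem ulamOp_posPart_fixed (hm : Measurable T) (hT : ∀ x, T x ∈ Ico (0 : ℝ) 1)
    {d : Fin k → ℝ} (hd : ulamOp T k d = d) : ulamOp T k d⁺ = d⁺ := by
  have hle (j : Fin k) : d⁺ j ≤ ulamOp T k d⁺ j := by
    refine max_le ?_ (ulamOp_nonneg (fun i => posPart_nonneg (d i)) j)
    conv_lhs => rw [← hd]
    simp only [ulamOp, Matrix.vecMul, dotProduct]
    exact Finset.sum_le_sum fun i _ =>
      mul_le_mul_of_nonneg_right (le_posPart (d i)) (ulamMatrix_nonneg T i j)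
  funext j
  exact ((Finset.sum_eq_sum_iff_of_le fun j _ => hle j).1 (sum_ulamOp hm hT d⁺).symm j
    (Finset.mem_univ j)).symm

theorem IsUlamDensity.sum_eq (hk : 1 ≤ k) (hv : IsUlamDensity T k v) : ∑ i, v i = k := by
  have hnorm := hv.2.2
  rwa [norm_stepL1 hv.1, div_eq_one_iff_eq (Nat.cast_ne_zero.2 (Nat.one_le_iff_ne_zero.1 hk))]
    at hnorm

theorem IsConvexBranched.ulamDensity_unique (h : IsConvexBranched T b c) {w : Fin k → ℝ}
    (hk : 1 ≤ k) (hv : IsUlamDensity T k v) (hw : IsUlamDensity T k w) : v = w := by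
  wlog h0 : v ⟨0, hk⟩ ≤ w ⟨0, hk⟩ generalizing v w
  · exact (this hw hv (le_of_not_ge h0)).symm
  have hd : ulamOp T k (v - w) = v - w := by
    rw [ulamOp, Matrix.sub_vecMul]
    exact congrArg₂ _ hv.2.1 hw.2.1
  have hzero : (v - w)⁺ = 0 := by
    refine h.eq_zero_of_fixed (fun i => posPart_nonneg ((v - w) i))
      (ulamOp_posPart_fixed h.measurable h.mapsTo hd) ?_
    rw [stepFn_of_mem _ (zero_mem_cell hk)]
    exact posPart_of_nonpos (sub_nonpos.2 h0)
  have hle : v ≤ w := sub_nonpos.1 (posPart_eq_zero.1 hzero)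
  funext i
  exact (Finset.sum_eq_sum_iff_of_le fun i _ => hle i).1 ((hv.sum_eq hk).trans (hw.sum_eq hk).symm)
    i (Finset.mem_univ i)

end Uniqueness

section Bound

theorem tsum_mul_min_le {s d : ℕ → ℝ} (hs : Summable s) (hs0 : ∀ m, 0 ≤ s m) (hd : ∀ m, 0 ≤ d m)
    {x : ℝ} (hx : 0 ≤ x) (N : ℕ) : Summable (fun m => s m * min x (d m)) ∧
      ∑' m, s m * min x (d m) ≤ ∑ m ∈ Finset.range N, s m * d m + (∑' m, s (m + N)) * x := by
  have hle (m : ℕ) : s m * min x (d m) ≤ s m * x :=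
    mul_le_mul_of_nonneg_left (min_le_left _ _) (hs0 m)
  have hsum : Summable fun m => s m * min x (d m) :=
    (hs.mul_right x).of_nonneg_of_le (fun m => mul_nonneg (hs0 m) (le_min hx (hd m))) hle
  refine ⟨hsum, ?_⟩
  rw [← hsum.sum_add_tsum_nat_add N, ← tsum_mul_right]
  refine add_le_add (Finset.sum_le_sum fun m _ =>
    mul_le_mul_of_nonneg_left (min_le_right _ _) (hs0 m)) ?_
  exact ((summable_nat_add_iff N).2 hsum).tsum_le_tsum (fun m => hle (m + N))
    (((summable_nat_add_iff N).2 hs).mul_right x)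

variable {k : ℕ} {v : Fin k → ℝ}

theorem stepFn_le_zero_apply (hk : 0 < k) (hv : ∀ i, 0 ≤ v i) (ha : Antitone v) (x : ℝ) :
    stepFn k v x ≤ v ⟨0, hk⟩ :=
  stepFn_le (hv _) (fun i => ha (Fin.le_def.2 i.1.zero_le)) x

theorem stepFn_mul_le_norm (hv : ∀ i, 0 ≤ v i) (ha : Antitone v) {x : ℝ}
    (hx : x ∈ Icc (0 : ℝ) 1) : stepFn k v x * x ≤ ‖stepL1 k v‖ := by
  rw [norm_stepL1 hv, ← integral_stepFn,
    ← densityMeasure_real_univ (integrable_stepFn k v) (ae_of_all _ (stepFn_nonneg hv))]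
  calc stepFn k v x * x = stepFn k v x * (x - 0) := by rw [sub_zero]
    _ ≤ (densityMeasure (stepFn k v)).real (Ico 0 x) := le_densityMeasure_stepFn_Ico hv
        (fun z hz => antitoneOn_stepFn hv ha hz.1 hx.1 hz.2.le) le_rfl hx.1 hx.2
    _ ≤ (densityMeasure (stepFn k v)).real univ := measureReal_mono (subset_univ _)

namespace IsConvexBranched

variable {T : ℝ → ℝ} {b c : ℕ → ℝ}

theorem branchInv_sub_le (h : IsConvexBranched T b c) (m : ℕ) {t : ℝ} (ht : 0 ≤ t) :
    branchInv T b m t - b (m + 1) ≤ t / c m := by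
  rw [sub_le_iff_le_add']
  refine csSup_le ⟨_, mem_insert _ _⟩ ?_
  rintro x (rfl | ⟨hx, hxt⟩)
  · exact le_add_of_nonneg_right (div_nonneg ht (h.branch m).slope_pos.le)
  · have hb := h.b_pos_of_mem hx
    have hslope := (h.branch m).mul_sub_le (h.left_mem hb) hx hx.1
    rw [h.map_left hb, sub_zero] at hslope
    rw [← sub_le_iff_le_add', le_div_iff₀ (h.branch m).slope_pos, mul_comm]
    exact hslope.trans hxt

theorem hasSum_ulamOp_zero (h : IsConvexBranched T b c) (hk : 0 < k) (hv : ∀ i, 0 ≤ v i) :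
    HasSum (fun m => k * (distFun (densityMeasure (stepFn k v)) (branchInv T b m (1 / k)) -
      distFun (densityMeasure (stepFn k v)) (b (m + 1)))) (ulamOp T k v ⟨0, hk⟩) := by
  have hfirst : T ⁻¹' cell k ⟨0, hk⟩ = T ⁻¹' Iio (1 / k) := by
    ext x
    simp [cell, (h.mapsTo x).1]
  rw [ulamOp_apply h.measurable hv, hfirst,
    ← map_measureReal_apply h.measurable measurableSet_Iio]
  exact (h.hasSum_distFun_map (densityMeasure_ac _) (1 / k)).mul_left (k : ℝ)

theorem branch_mass_le (h : IsConvexBranched T b c) (hk : 0 < k) (hv : ∀ i, 0 ≤ v i)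
    (ha : Antitone v) (m : ℕ) :
    k * (distFun (densityMeasure (stepFn k v)) (branchInv T b m (1 / k)) -
      distFun (densityMeasure (stepFn k v)) (b (m + 1))) ≤ stepFn k v (b (m + 1)) / c m := by
  have hk0 : (0 : ℝ) < k := Nat.cast_pos.2 hk
  have hb := h.b_nonneg (m + 1)
  have hmem := h.branchInv_mem m (1 / k)
  rw [← measureReal_Ico _ hmem.1]
  calc k * (densityMeasure (stepFn k v)).real (Ico (b (m + 1)) (branchInv T b m (1 / k)))
      ≤ k * (stepFn k v (b (m + 1)) * (branchInv T b m (1 / k) - b (m + 1))) :=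
        mul_le_mul_of_nonneg_left (densityMeasure_stepFn_Ico_le hv
          (fun z hz => antitoneOn_stepFn hv ha hb (hb.trans hz.1) hz.1) hb hmem.1
          (hmem.2.trans (h.b_le_one m))) hk0.le
    _ ≤ k * (stepFn k v (b (m + 1)) * (1 / k / c m)) := by
        gcongr
        · exact stepFn_nonneg hv _
        · exact h.branchInv_sub_le m (by positivity)
    _ = stepFn k v (b (m + 1)) / c m := by field_simp

end IsConvexBranched

namespace IsPiecewiseConvexZero

variable {τ : ℝ → ℝ} {a : ℕ → ℝ}

theorem existsUnique_ulamDensity (hτ : IsPiecewiseConvexZero τ a) {n : ℕ} (hn : 1 ≤ n)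
    (hk : 1 ≤ k) : ∃! v : Fin k → ℝ, IsUlamDensity (approxMap τ a n) k v := by
  simp only [← isUlamDensity_congr (indicator_Ioo_ae_eq (approxMap τ a n))]
  have h := hτ.approx_isConvexBranched hn
  obtain ⟨v, hv, -⟩ := h.exists_antitone_ulamDensity hk
  exact ⟨v, hv, fun w hw => h.ulamDensity_unique hk hw hv⟩

theorem antitone_ulamDensity (hτ : IsPiecewiseConvexZero τ a) {n : ℕ} (hn : 1 ≤ n)
    (hk : 1 ≤ k) (hv : IsUlamDensity (approxMap τ a n) k v) : Antitone v := by
  have h := hτ.approx_isConvexBranched hn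
  obtain ⟨w, hw, ha⟩ := h.exists_antitone_ulamDensity hk
  rw [isUlamDensity_congr (indicator_Ioo_ae_eq (approxMap τ a n))] at hw
  rwa [(hτ.existsUnique_ulamDensity hn hk).unique hv hw]

theorem approx_branch_mass_le (hτ : IsPiecewiseConvexZero τ a) {n : ℕ} (hn : 1 ≤ n) (hk : 1 ≤ k)
    (hv : IsUlamDensity (approxMap τ a n) k v) (m : ℕ) :
    k * (distFun (densityMeasure (stepFn k v))
        (branchInv ((Ioo (0 : ℝ) 1).indicator (approxMap τ a n)) (approxPoints a n) m (1 / k)) -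
      distFun (densityMeasure (stepFn k v)) (approxPoints a n (m + 1)))
      ≤ 1 / branchSlope τ a m * min (v ⟨0, hk⟩) (1 / a (m + 1)) +
        if m = n then a n * v ⟨0, hk⟩ else 0 := by
  have h := hτ.approx_isConvexBranched hn
  have ha := hτ.antitone_ulamDensity hn hk hv
  have hv₀ := stepFn_le_zero_apply hk hv.1 ha
  have hslope : 0 ≤ 1 / branchSlope τ a m := one_div_nonneg.2 (hτ.branchSlope_pos m).le
  have ham := hτ.a_pos (m + 1)
  have hmin : 0 ≤ 1 / branchSlope τ a m * min (v ⟨0, hk⟩) (1 / a (m + 1)) :=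
    mul_nonneg hslope (le_min (hv.1 _) (one_div_nonneg.2 ham.le))
  have hmass := h.branch_mass_le hk hv.1 ha m
  rcases lt_trichotomy m n with hm | rfl | hm
  · rw [if_neg hm.ne, add_zero, mul_comm (1 / _), mul_one_div]
    rw [approxSlope, if_neg hm.ne] at hmass
    rw [approxPoints_of_le (show m + 1 ≤ n from hm)] at hmass ⊢
    refine hmass.trans (div_le_div_of_nonneg_right (le_min (hv₀ _) ?_) (hτ.branchSlope_pos m).le)
    exact (le_div_iff₀ ham).2
      ((stepFn_mul_le_norm hv.1 ha ⟨ham.le, hτ.a_le_one _⟩).trans_eq hv.2.2)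
  · rw [approxSlope, if_pos rfl, one_div (a m), div_inv_eq_mul,
      mul_comm (stepFn k v _)] at hmass
    rw [if_pos rfl]
    exact (hmass.trans (mul_le_mul_of_nonneg_left (hv₀ _) (hτ.a_pos m).le)).trans
      (le_add_of_nonneg_left hmin)
  · have hempty := h.branchInv_mem m (1 / k)
    rw [approxPoints_of_lt hm, approxPoints_of_lt (hm.trans m.lt_succ_self), Icc_self,
      mem_singleton_iff] at hempty
    rw [hempty, approxPoints_of_lt (hm.trans m.lt_succ_self), sub_self, mul_zero,
      if_neg hm.ne', add_zero]
    exact hmin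

theorem ulamDensity_zero_le (hτ : IsPiecewiseConvexZero τ a) {n : ℕ} (hn : 1 ≤ n) (hk : 1 ≤ k)
    (hv : IsUlamDensity (approxMap τ a n) k v) (N : ℕ) :
    v ⟨0, hk⟩ ≤ ∑ m ∈ Finset.range N, 1 / branchSlope τ a m * (1 / a (m + 1)) +
      (∑' m, 1 / branchSlope τ a (m + N)) * v ⟨0, hk⟩ + a n * v ⟨0, hk⟩ := by
  have hmass := (hτ.approx_isConvexBranched hn).hasSum_ulamOp_zero hk hv.1
  rw [ulamOp, ulamMatrix_congr (indicator_Ioo_ae_eq _), ← ulamOp, hv.2.1] at hmass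
  obtain ⟨hsum, hle⟩ := tsum_mul_min_le (d := fun m => 1 / a (m + 1)) hτ.summable_inv_deriv
    (fun m => one_div_nonneg.2 (hτ.branchSlope_pos m).le)
    (fun m => one_div_nonneg.2 (hτ.a_pos (m + 1)).le) (hv.1 ⟨0, hk⟩) N
  exact (hasSum_le (hτ.approx_branch_mass_le hn hk hv) hmass
    (hsum.hasSum.add (hasSum_ite_eq n _))).trans (add_le_add_left hle _)

theorem exists_ulamDensity_le (hτ : IsPiecewiseConvexZero τ a) : ∃ C : ℝ, 0 ≤ C ∧
    ∀ n k : ℕ, 1 ≤ n → 1 ≤ k → ∀ v : Fin k → ℝ, IsUlamDensity (approxMap τ a n) k v →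
      ∀ i, v i ≤ C := by
  have hgap : 0 < (1 - a 1) / 2 := half_pos (sub_pos.2 (hτ.a_lt_one le_rfl))
  have htail := tendsto_sum_nat_add fun m => 1 / branchSlope τ a m
  obtain ⟨N, hN⟩ := (htail.eventually (gt_mem_nhds hgap)).exists
  set K := ∑ m ∈ Finset.range N, 1 / branchSlope τ a m * (1 / a (m + 1))
  have hK : 0 ≤ K := Finset.sum_nonneg fun m _ => mul_nonneg
    (one_div_nonneg.2 (hτ.branchSlope_pos m).le) (one_div_nonneg.2 (hτ.a_pos (m + 1)).le)
  refine ⟨K / ((1 - a 1) / 2), div_nonneg hK hgap.le, fun n k hn hk v hv i => ?_⟩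
  have hi : v i ≤ v ⟨0, hk⟩ := hτ.antitone_ulamDensity hn hk hv (Fin.le_def.2 i.1.zero_le)
  refine hi.trans ((le_div_iff₀ hgap).2 ?_)
  have hzero := hτ.ulamDensity_zero_le hn hk hv N
  have htail_le := mul_le_mul_of_nonneg_right hN.le (hv.1 ⟨0, hk⟩)
  have han_le := mul_le_mul_of_nonneg_right (hτ.a_anti.antitone hn) (hv.1 ⟨0, hk⟩)
  linarith

end IsPiecewiseConvexZero

end Bound

section Compactness

theorem exists_subseq_tendsto_of_lipschitzWith {X Y : Type*} [PseudoMetricSpace X]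
    [TopologicalSpace.SeparableSpace X] [MetricSpace Y] {K : Set Y} (hK : IsCompact K) {C : ℝ≥0}
    {G : ℕ → X → Y} (hGK : ∀ j x, G j x ∈ K) (hG : ∀ j, LipschitzWith C (G j)) :
    ∃ (F : X → Y) (φ : ℕ → ℕ), LipschitzWith C F ∧ StrictMono φ ∧
      ∀ x, Tendsto (fun j => G (φ j) x) atTop (𝓝 (F x)) := by
  obtain ⟨s, hs, hsd⟩ := TopologicalSpace.exists_countable_dense X
  have := hs.to_subtype
  have hcompact : IsCompact (univ.pi (fun _ : X => K) ∩ {F | LipschitzWith C F}) :=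
    (isCompact_univ_pi fun _ => hK).inter_right (isClosed_setOfPred_lipschitzWith C)
  obtain ⟨F, ⟨-, hF⟩, hcluster⟩ := hcompact.exists_mapClusterPt (f := atTop) (u := G)
    (tendsto_principal.2 (Eventually.of_forall fun j => ⟨fun x _ => hGK j x, hG j⟩))
  have hrestrict : MapClusterPt (s.domRestrict F) atTop fun j => s.domRestrict (G j) :=
    hcluster.continuousAt_comp (f := s.domRestrict) (Pi.continuous_domRestrict s).continuousAt
  obtain ⟨φ, hφ, hlim⟩ := hrestrict.tendsto_subseq
  refine ⟨F, φ, hF, hφ, fun x => ?_⟩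
  have hequi : Equicontinuous fun j => G (φ j) :=
    (LipschitzWith.uniformEquicontinuous _ C fun j => hG (φ j)).equicontinuous
  exact (hequi.isClosed_setOfPred_tendsto hF.continuous).closure_subset_iff.2
    (fun y hy => tendsto_pi_nhds.1 hlim ⟨y, hy⟩) (hsd x)

theorem isCompact_closure_of_exists_subseq {X : Type*} [PseudoMetricSpace X] {S : Set X}
    (h : ∀ u : ℕ → X, (∀ j, u j ∈ S) →
      ∃ (x : X) (φ : ℕ → ℕ), StrictMono φ ∧ Tendsto (fun j => u (φ j)) atTop (𝓝 x)) :
    IsCompact (closure S) := by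
  refine IsSeqCompact.isCompact fun u hu => ?_
  choose w hwS hw using fun j : ℕ =>
    Metric.mem_closure_iff.1 (hu j) (1 / ((j : ℝ) + 1)) Nat.one_div_pos_of_nat
  obtain ⟨x, φ, hφ, hlim⟩ := h w hwS
  refine ⟨x, mem_closure_of_tendsto hlim (Eventually.of_forall fun j => hwS _), φ, hφ, ?_⟩
  refine (tendsto_iff_of_dist ?_).2 hlim
  exact squeeze_zero (fun _ => dist_nonneg) (fun j => (hw _).le)
    (tendsto_one_div_add_atTop_nhds_zero_nat.comp hφ.tendsto_atTop)

theorem isCompact_closure_toWeakSpace_image {E : Type*} [NormedAddCommGroup E] [NormedSpace ℝ E]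
    {S : Set E} (h : IsCompact (closure S)) : IsCompact (closure (toWeakSpace ℝ E '' S)) :=
  have himage := h.image (toWeakSpaceCLM ℝ E).continuous
  himage.of_isClosed_subset isClosed_closure
    (closure_minimal (image_mono subset_closure) himage.isClosed)

end Compactness

section IntegralConvergence

theorem ae_hasDerivAt_setIntegral_Iio {f : ℝ → ℝ} (hf : Integrable f) :
    ∀ᵐ x, HasDerivAt (fun t => ∫ y in Iio t, f y) (f x) x := by
  have hsplit : (fun t => ∫ y in Iio t, f y) =
      fun t => (∫ y in Iic 0, f y) + ∫ y in (0 : ℝ)..t, f y := by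
    funext t
    rw [← integral_Iic_eq_integral_Iio,
      ← intervalIntegral.integral_Iic_sub_Iic hf.integrableOn hf.integrableOn, add_sub_cancel]
  rw [hsplit]
  filter_upwards [_root_.LocallyIntegrable.ae_hasDerivAt_integral hf.locallyIntegrable] with x hx
  exact (hx 0).const_add _

theorem ae_hasDerivAt_setIntegral_Iio_lebI {f : ℝ → ℝ} (hf : Integrable f lebI) :
    ∀ᵐ x ∂lebI, HasDerivAt (fun t => ∫ y in Iio t, f y ∂lebI) (f x) x := by
  have hindicator : ∀ t, ∫ y in Iio t, f y ∂lebI = ∫ y in Iio t, (Icc (0 : ℝ) 1).indicator f y :=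
    fun t => by
      rw [lebI, Measure.restrict_restrict measurableSet_Iio,
        setIntegral_indicator measurableSet_Icc]
  simp only [hindicator]
  filter_upwards [ae_lebI_mem_Ioo, ae_restrict_of_ae (ae_hasDerivAt_setIntegral_Iio
    ((integrable_indicator_iff measurableSet_Icc).2 hf))] with x hx hd
  rwa [indicator_of_mem (Ioo_subset_Icc_self hx)] at hd

theorem tendsto_setIntegral_of_tendsto_toWeakSpace {α ι : Type*} [MeasurableSpace α]
    {μ : Measure α} {l : Filter ι} {u : ι → Lp ℝ 1 μ} {f : Lp ℝ 1 μ}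
    (h : Tendsto (fun j => toWeakSpace ℝ (Lp ℝ 1 μ) (u j)) l (𝓝 (toWeakSpace ℝ (Lp ℝ 1 μ) f)))
    (A : Set α) : Tendsto (fun j => ∫ x in A, u j x ∂μ) l (𝓝 (∫ x in A, f x ∂μ)) := by
  have : Fact ((1 : ℝ≥0∞) ≤ 1) := ⟨le_rfl⟩
  set φ : StrongDual ℝ (Lp ℝ 1 μ) :=
    (L1.integralCLM (E := ℝ) (μ := μ.restrict A)).comp (LpToLpRestrictCLM α ℝ ℝ μ 1 A)
  have hφ : ∀ g : Lp ℝ 1 μ, φ g = ∫ x in A, g x ∂μ := fun g => by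
    rw [← integral_congr_ae (LpToLpRestrictCLM_coeFn ℝ A g), ← L1.integral_eq_integral,
      L1.integral_eq]
    rfl
  simp only [← hφ]
  exact ((WeakBilin.eval_continuous (topDualPairing ℝ (Lp ℝ 1 μ)).flip φ).tendsto _).comp h

theorem tendsto_toL1_of_dominated_convergence {α E ι : Type*} [MeasurableSpace α] {μ : Measure α}
    [NormedAddCommGroup E] {l : Filter ι} [l.IsCountablyGenerated] {F : ι → α → E}
    {f : α → E} {bound : α → ℝ} (hF : ∀ j, Integrable (F j) μ) (hf : Integrable f μ)
    (hbound : Integrable bound μ) (hle : ∀ᶠ j in l, ∀ᵐ x ∂μ, ‖F j x‖ ≤ bound x)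
    (hlim : ∀ᵐ x ∂μ, Tendsto (fun j => F j x) l (𝓝 (f x))) :
    Tendsto (fun j => (hF j).toL1 (F j)) l (𝓝 (hf.toL1 f)) := by
  rw [tendsto_iff_norm_sub_tendsto_zero]
  simp only [← Integrable.toL1_sub, L1.norm_of_fun_eq_integral_norm]
  rw [← integral_zero α ℝ (μ := μ)]
  refine tendsto_integral_filter_of_dominated_convergence (fun x => bound x + ‖f x‖)
    (Eventually.of_forall fun j => ((hF j).sub hf).1.norm) ?_ (hbound.add hf.norm) ?_
  · filter_upwards [hle] with j hj
    filter_upwards [hj] with x hx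
    rw [norm_norm]
    exact (norm_sub_le _ _).trans (add_le_add_left hx _)
  · filter_upwards [hlim] with x hx
    exact tendsto_iff_norm_sub_tendsto_zero.1 hx

end IntegralConvergence

section Convergence

theorem densityMeasure_real_le {f : ℝ → ℝ} {C : ℝ≥0} (hC : ∀ x, f x ≤ C) (A : Set ℝ) :
    (densityMeasure f).real A ≤ C * lebI.real A := by
  have hle : densityMeasure f ≤ (C : ℝ≥0∞) • lebI := by
    rw [← withDensity_const]
    refine withDensity_mono (ae_of_all _ fun x => ?_)
    exact ENNReal.ofReal_le_of_le_toReal (hC x)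
  exact (ENNReal.toReal_mono (ENNReal.mul_ne_top ENNReal.coe_ne_top (measure_ne_top lebI A))
    (hle A)).trans_eq ENNReal.toReal_mul

theorem lipschitzWith_distFun_densityMeasure {f : ℝ → ℝ} (hf : Integrable f lebI) {C : ℝ≥0}
    (hC : ∀ x, f x ≤ C) : LipschitzWith C (distFun (densityMeasure f)) := by
  have := isFiniteMeasure_densityMeasure hf
  refine LipschitzWith.of_le_add_mul C fun s t => ?_
  rcases le_total s t with hst | hst
  · exact (distFun_mono _ hst).trans (le_add_of_nonneg_right (by positivity))
  · rw [← sub_le_iff_le_add', ← measureReal_Ico _ hst, Real.dist_eq,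
      abs_of_nonneg (sub_nonneg.2 hst)]
    exact (densityMeasure_real_le hC _).trans
      (mul_le_mul_of_nonneg_left (lebI_real_Ico_le hst) C.2)

/-- The values on the `k` cells of a decreasing step function with values in `[0, C]`. -/
structure IsBoundedAntitone (C : ℝ≥0) {k : ℕ} (v : Fin k → ℝ) : Prop where
  nonneg : ∀ i, 0 ≤ v i
  antitone : Antitone v
  le : ∀ i, v i ≤ C

namespace IsBoundedAntitone

variable {C : ℝ≥0}

theorem lipschitzWith_distFun {k : ℕ} {v : Fin k → ℝ} (hv : IsBoundedAntitone C v) :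
    LipschitzWith C (distFun (densityMeasure (stepFn k v))) :=
  lipschitzWith_distFun_densityMeasure (integrable_stepFn k v) (stepFn_le C.2 hv.le)

theorem distFun_mem_Icc {k : ℕ} {v : Fin k → ℝ} (hv : IsBoundedAntitone C v) (t : ℝ) :
    distFun (densityMeasure (stepFn k v)) t ∈ Icc (0 : ℝ) C := by
  refine ⟨measureReal_nonneg, (densityMeasure_real_le (stepFn_le C.2 hv.le) _).trans ?_⟩
  exact mul_le_of_le_one_right C.2 ((measureReal_mono (subset_univ _)).trans_eq lebI_real_univ)

variable {ι : Type*} {l : Filter ι} {k : ι → ℕ} {v : (j : ι) → Fin (k j) → ℝ}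

theorem tendsto_stepFn_of_hasDerivAt (hv : ∀ᶠ j in l, IsBoundedAntitone C (v j)) {F : ℝ → ℝ}
    (hF : ∀ t, Tendsto (fun j => distFun (densityMeasure (stepFn (k j) (v j))) t) l (𝓝 (F t)))
    {x d : ℝ} (hx : x ∈ Ioo (0 : ℝ) 1) (hd : HasDerivAt F d x) :
    Tendsto (fun j => stepFn (k j) (v j) x) l (𝓝 d) := by
  -- By monotonicity the value at `x` lies between the slopes of the distribution function on the
  -- two sides of `x`, and these slopes converge to those of `F`.
  rw [hasDerivAt_iff_tendsto_slope_left_right] at hd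
  refine tendsto_order.2 ⟨fun d' hd' => ?_, fun d' hd' => ?_⟩
  · obtain ⟨y, hslope, hy⟩ :=
      ((hd.2.eventually (lt_mem_nhds hd')).and (Ioo_mem_nhdsGT hx.2)).exists
    rw [slope_def_field] at hslope
    filter_upwards [(((hF y).sub (hF x)).div_const (y - x)).eventually (lt_mem_nhds hslope), hv]
      with j hj hvj
    refine hj.trans_le ?_
    rw [← measureReal_Ico _ hy.1.le, div_le_iff₀ (sub_pos.2 hy.1)]
    exact densityMeasure_stepFn_Ico_le hvj.nonneg (fun z hz => antitoneOn_stepFn hvj.nonneg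
      hvj.antitone hx.1.le (hx.1.le.trans hz.1) hz.1) hx.1.le hy.1.le hy.2.le
  · obtain ⟨y, hslope, hy⟩ :=
      ((hd.1.eventually (gt_mem_nhds hd')).and (Ioo_mem_nhdsLT hx.1)).exists
    rw [slope_comm, slope_def_field] at hslope
    filter_upwards [(((hF x).sub (hF y)).div_const (x - y)).eventually (gt_mem_nhds hslope), hv]
      with j hj hvj
    refine lt_of_le_of_lt ?_ hj
    rw [← measureReal_Ico _ hy.2.le, le_div_iff₀ (sub_pos.2 hy.2)]
    exact le_densityMeasure_stepFn_Ico hvj.nonneg (fun z hz => antitoneOn_stepFn hvj.nonneg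
      hvj.antitone (hy.1.le.trans hz.1) hx.1.le hz.2.le) hy.1.le hy.2.le hx.2.le

theorem tendsto_stepL1_of_ae [l.IsCountablyGenerated]
    (hv : ∀ᶠ j in l, IsBoundedAntitone C (v j)) {f : Lp ℝ 1 lebI}
    (h : ∀ᵐ x ∂lebI, Tendsto (fun j => stepFn (k j) (v j) x) l (𝓝 (f x))) :
    Tendsto (fun j => stepL1 (k j) (v j)) l (𝓝 f) := by
  rw [← Integrable.toL1_coeFn f (L1.integrable_coeFn f)]
  refine tendsto_toL1_of_dominated_convergence (fun j => integrable_stepFn (k j) (v j)) _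
    (integrable_const (C : ℝ)) ?_ h
  filter_upwards [hv] with j hj
  refine ae_of_all _ fun x => ?_
  rw [Real.norm_of_nonneg (stepFn_nonneg hj.nonneg x)]
  exact stepFn_le C.2 hj.le x

theorem ae_tendsto_stepFn_of_tendsto_setIntegral (hv : ∀ᶠ j in l, IsBoundedAntitone C (v j))
    {f : Lp ℝ 1 lebI} (h : ∀ t, Tendsto (fun j => ∫ x in Iio t, stepL1 (k j) (v j) x ∂lebI) l
      (𝓝 (∫ x in Iio t, f x ∂lebI))) :
    ∀ᵐ x ∂lebI, Tendsto (fun j => stepFn (k j) (v j) x) l (𝓝 (f x)) := by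
  filter_upwards [ae_lebI_mem_Ioo, ae_hasDerivAt_setIntegral_Iio_lebI (L1.integrable_coeFn f)]
    with x hx hd
  refine tendsto_stepFn_of_hasDerivAt hv (fun t => (h t).congr' ?_) hx hd
  filter_upwards [hv] with j hj
  rw [distFun_densityMeasure (integrable_stepFn _ _) (ae_of_all _ (stepFn_nonneg hj.nonneg))]
  exact integral_congr_ae (ae_restrict_of_ae (stepL1_ae_eq _ _))

theorem exists_subseq_tendsto_stepL1 {k : ℕ → ℕ} {v : (j : ℕ) → Fin (k j) → ℝ}
    (hv : ∀ᶠ j in atTop, IsBoundedAntitone C (v j)) :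
    ∃ (f : Lp ℝ 1 lebI) (φ : ℕ → ℕ), StrictMono φ ∧
      Tendsto (fun j => stepL1 (k (φ j)) (v (φ j))) atTop (𝓝 f) := by
  obtain ⟨J, hJ⟩ := eventually_atTop.1 hv
  have hvJ : ∀ j, IsBoundedAntitone C (v (j + J)) := fun j => hJ _ (Nat.le_add_left J j)
  obtain ⟨F, φ, hF, hφ, hlim⟩ := exists_subseq_tendsto_of_lipschitzWith isCompact_Icc
    (fun j => (hvJ j).distFun_mem_Icc) (fun j => (hvJ j).lipschitzWith_distFun)
  have hderiv : MemLp (deriv F) 1 lebI :=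
    MemLp.of_bound (measurable_deriv F).aestronglyMeasurable C
      (ae_of_all _ fun x => norm_deriv_le_of_lipschitz hF)
  have hvφ : ∀ᶠ j in atTop, IsBoundedAntitone C (v (φ j + J)) :=
    Eventually.of_forall fun j => hvJ (φ j)
  refine ⟨hderiv.toLp _, fun j => φ j + J, hφ.add_const J, tendsto_stepL1_of_ae hvφ ?_⟩
  filter_upwards [ae_lebI_mem_Ioo, ae_restrict_of_ae hF.ae_differentiableAt_real,
    hderiv.coeFn_toLp] with x hx hd hx'
  rw [hx']
  exact tendsto_stepFn_of_hasDerivAt hvφ hlim hx hd.hasDerivAt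

theorem isCompact_closure_toWeakSpace {S : Set (Lp ℝ 1 lebI)}
    (hS : ∀ g ∈ S, ∃ (k : ℕ) (v : Fin k → ℝ), IsBoundedAntitone C v ∧ g = stepL1 k v) :
    IsCompact (closure (toWeakSpace ℝ (Lp ℝ 1 lebI) '' S)) := by
  refine isCompact_closure_toWeakSpace_image (isCompact_closure_of_exists_subseq fun u hu => ?_)
  choose k v hv huv using fun j => hS (u j) (hu j)
  simp only [huv]
  exact exists_subseq_tendsto_stepL1 (Eventually.of_forall hv)

end IsBoundedAntitone

theorem IsPiecewiseConvexZero.exists_isBoundedAntitone {τ : ℝ → ℝ} {a : ℕ → ℝ}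
    (hτ : IsPiecewiseConvexZero τ a) : ∃ C : ℝ≥0, ∀ n k : ℕ, 1 ≤ n → 1 ≤ k →
      ∀ v : Fin k → ℝ, IsUlamDensity (approxMap τ a n) k v → IsBoundedAntitone C v := by
  obtain ⟨C, hC, hle⟩ := hτ.exists_ulamDensity_le
  exact ⟨⟨C, hC⟩, fun n k hn hk v hv =>
    ⟨hv.1, hτ.antitone_ulamDensity hn hk hv, hle n k hn hk v hv⟩⟩

end Convergence

section Invariance

theorem IsConvexBranch.volume_preimage_inter_Ico {g : ℝ → ℝ} {l r c : ℝ}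
    (h : IsConvexBranch g l r c) {N : Set ℝ} (hN : volume N = 0) :
    volume (g ⁻¹' N ∩ Ico l r) = 0 := by
  have hanti : AntilipschitzWith ⟨c⁻¹, (inv_pos.2 h.slope_pos).le⟩ ((Ico l r).domRestrict g) := by
    refine AntilipschitzWith.of_le_mul_dist fun x y => ?_
    wlog hxy : (x : ℝ) ≤ y generalizing x y
    · rw [dist_comm, dist_comm ((Ico l r).domRestrict g x)]
      exact this y x (le_of_not_ge hxy)
    rw [dist_comm, dist_comm ((Ico l r).domRestrict g x), Subtype.dist_eq, Real.dist_eq,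
      Real.dist_eq, abs_of_nonneg (sub_nonneg.2 hxy)]
    exact (le_inv_mul_iff₀ h.slope_pos).2 ((h.mul_sub_le x.2 y.2 hxy).trans (le_abs_self _))
  have hpre := hanti.hausdorffMeasure_preimage_le zero_le_one N
  rw [hausdorffMeasure_real, hN, mul_zero, nonpos_iff_eq_zero] at hpre
  rw [← hausdorffMeasure_real, inter_comm, ← Subtype.image_preimage_coe,
    isometry_subtype_coe.hausdorffMeasure_image (Or.inl zero_le_one)]
  exact hpre

variable {T : ℝ → ℝ} {b c : ℕ → ℝ}

theorem IsConvexBranched.nonsingular (h : IsConvexBranched T b c) : lebI.map T ≪ lebI := by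
  refine Measure.AbsolutelyContinuous.mk fun N hN h0 => ?_
  rw [lebI, Measure.restrict_apply hN] at h0
  rw [Measure.map_apply h.measurable hN]
  have hbranch : lebI (⋃ m, T ⁻¹' (N ∩ Icc 0 1) ∩ Ico (b (m + 1)) (b m)) = 0 :=
    measure_iUnion_null fun m => Measure.absolutelyContinuous_of_le Measure.restrict_le_self
      ((h.branch m).volume_preimage_inter_Ico h0)
  refine measure_mono_null_ae ?_ hbranch
  filter_upwards [h.ae_mem_iUnion_branch] with x hx hxN
  rw [← inter_iUnion]
  exact ⟨⟨hxN, Ico_subset_Icc_self (h.mapsTo x)⟩, hx⟩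

theorem IsConvexBranched.map_ac (h : IsConvexBranched T b c) {μ : Measure ℝ} (hμ : μ ≪ lebI) :
    μ.map T ≪ lebI :=
  (hμ.map h.measurable).trans h.nonsingular

theorem frobeniusPerron_fixed_iff {τ : ℝ → ℝ} (he : τ =ᵐ[lebI] T) (hm : Measurable T)
    (hns : lebI.map T ≪ lebI) (f : Lp ℝ 1 lebI) :
    frobeniusPerron τ f =ᵐ[lebI] f ↔ ∀ A, MeasurableSet A →
      ∫ x in T ⁻¹' A, f x ∂lebI = ∫ x in A, f x ∂lebI := by
  have hf := L1.integrable_coeFn f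
  obtain ⟨hP, hspec⟩ := frobeniusPerron_spec ⟨T, hm, he⟩ (by rwa [Measure.map_congr he]) hf
  have hpre : ∀ A : Set ℝ, ∫ x in τ ⁻¹' A, f x ∂lebI = ∫ x in T ⁻¹' A, f x ∂lebI := fun A =>
    setIntegral_congr_set (he.preimage A)
  constructor
  · intro h A hA
    rw [← hpre, ← hspec A hA]
    exact integral_congr_ae (ae_restrict_of_ae h)
  · intro h
    refine hP.ae_eq_of_forall_setIntegral_eq _ _ hf fun A hA _ => ?_
    rw [hspec A hA, hpre, h A hA]

theorem map_densityMeasure_eq_iff {f : ℝ → ℝ} (hf : Integrable f lebI) (h0 : 0 ≤ᵐ[lebI] f)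
    (hm : Measurable T) : (densityMeasure f).map T = densityMeasure f ↔
      ∀ A, MeasurableSet A → ∫ x in T ⁻¹' A, f x ∂lebI = ∫ x in A, f x ∂lebI := by
  have := isFiniteMeasure_densityMeasure hf
  have hreal : ∀ A, MeasurableSet A →
      ((densityMeasure f).map T).real A = ∫ x in T ⁻¹' A, f x ∂lebI := fun A hA => by
    rw [map_measureReal_apply hm hA, densityMeasure_real hf h0 (hm hA)]
  constructor
  · intro h A hA
    rw [← hreal A hA, h, densityMeasure_real hf h0 hA]
  · intro h
    ext A hA
    rw [← measureReal_eq_measureReal_iff, hreal A hA, h A hA, densityMeasure_real hf h0 hA]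

variable {k : ℕ} {v : Fin k → ℝ}

theorem densityMeasure_stepFn_cell (hv : ∀ i, 0 ≤ v i) (j : Fin k) :
    (densityMeasure (stepFn k v)).real (cell k j) = v j / k := by
  rw [densityMeasure_stepFn_real hv (measurableSet_cell j), Finset.sum_eq_single j, inter_self,
    lebI_real_cell, mul_one_div]
  · intro i _ hij
    rw [(pairwise_disjoint_cell hij.symm).inter_eq, measureReal_empty, mul_zero]
  · simp

theorem IsUlamDensity.map_cell (hv : IsUlamDensity T k v) (hm : Measurable T) (j : Fin k) :
    ((densityMeasure (stepFn k v)).map T).real (cell k j) =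
      (densityMeasure (stepFn k v)).real (cell k j) := by
  have hfix := ulamOp_apply hm hv.1 j
  rw [hv.2.1] at hfix
  rw [map_measureReal_apply hm (measurableSet_cell j), densityMeasure_stepFn_cell hv.1, hfix,
    mul_div_cancel_left₀ _ (natCast_pos_of_fin j).ne']

namespace IsConvexBranched

theorem distFun_map_grid (h : IsConvexBranched T b c) (hv : IsUlamDensity T k v) {p : ℕ}
    (hp : p ≤ k) : distFun ((densityMeasure (stepFn k v)).map T) (p / k) =
      distFun (densityMeasure (stepFn k v)) (p / k) := by
  have hac := densityMeasure_ac (stepFn k v)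
  induction p with
  | zero =>
    simp only [Nat.cast_zero, zero_div, distFun_of_nonpos hac le_rfl,
      distFun_of_nonpos (h.map_ac hac) le_rfl]
  | succ p ih =>
    have hle := (cell_left_lt_right (⟨p, hp⟩ : Fin k)).le
    have hcell := hv.map_cell h.measurable ⟨p, hp⟩
    rw [cell, measureReal_Ico _ hle, measureReal_Ico _ hle] at hcell
    have := ih (p.le_succ.trans hp)
    push_cast
    linarith

theorem abs_distFun_map_sub_le (h : IsConvexBranched T b c) (hk : 1 ≤ k)
    (hv : IsUlamDensity T k v) {C : ℝ≥0} (hC : ∀ i, v i ≤ C) (y : ℝ) :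
    |distFun ((densityMeasure (stepFn k v)).map T) y - distFun (densityMeasure (stepFn k v)) y|
      ≤ C / k := by
  set μ := densityMeasure (stepFn k v)
  have hμ : μ ≪ lebI := densityMeasure_ac _
  rcases le_or_gt y 0 with hy0 | hy0
  · rw [distFun_of_nonpos hμ hy0, distFun_of_nonpos (h.map_ac hμ) hy0, sub_zero, abs_zero]
    positivity
  rcases le_or_gt 1 y with hy1 | hy1
  · rw [distFun_of_one_le hμ hy1, distFun_of_one_le (h.map_ac hμ) hy1,
      map_measureReal_apply h.measurable MeasurableSet.univ, preimage_univ, sub_self, abs_zero]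
    positivity
  obtain ⟨i, hi⟩ := exists_mem_cell hk ⟨hy0.le, hy1⟩
  have hcell : distFun μ ((i + 1) / k) - distFun μ (i / k) ≤ C / k := by
    rw [← measureReal_Ico _ (cell_left_lt_right i).le]
    exact (densityMeasure_real_le (stepFn_le C.2 hC) (cell k i)).trans_eq
      (by rw [lebI_real_cell, mul_one_div])
  have hleft := h.distFun_map_grid hv i.isLt.le
  have hright := h.distFun_map_grid hv (Nat.succ_le_iff.2 i.isLt)
  rw [Nat.cast_succ] at hright
  rw [abs_sub_le_iff]
  constructor <;>
  linarith [distFun_mono μ hi.1, distFun_mono μ hi.2.le, distFun_mono (μ.map T) hi.1,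
    distFun_mono (μ.map T) hi.2.le]

end IsConvexBranched

theorem abs_distFun_map_sub_map_le {μ : Measure ℝ} [IsFiniteMeasure μ] {S T : ℝ → ℝ}
    (hS : Measurable S) (hT : Measurable T) {D : Set ℝ} (hST : EqOn S T Dᶜ) (t : ℝ) :
    |distFun (μ.map S) t - distFun (μ.map T) t| ≤ μ.real D := by
  rw [distFun, distFun, map_measureReal_apply hS measurableSet_Iio,
    map_measureReal_apply hT measurableSet_Iio]
  have hle : ∀ {f g : ℝ → ℝ}, EqOn f g Dᶜ →
      μ.real (f ⁻¹' Iio t) - μ.real (g ⁻¹' Iio t) ≤ μ.real D := fun {f g} hfg => by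
    rw [sub_le_iff_le_add']
    refine (measureReal_mono fun x hx => ?_).trans (measureReal_union_le _ _)
    exact or_iff_not_imp_right.2 fun hxD => (hfg hxD).symm.trans_lt hx
  exact abs_sub_le_iff.2 ⟨hle hST, hle hST.symm⟩

namespace IsPiecewiseConvexZero

variable {τ : ℝ → ℝ} {a : ℕ → ℝ}

theorem abs_distFun_map_sub_le (hτ : IsPiecewiseConvexZero τ a) {n k : ℕ} (hn : 1 ≤ n)
    (hk : 1 ≤ k) {v : Fin k → ℝ} (hv : IsUlamDensity (approxMap τ a n) k v) {C : ℝ≥0}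
    (hC : ∀ i, v i ≤ C) (t : ℝ) :
    |distFun ((densityMeasure (stepFn k v)).map ((Ioo 0 1).indicator τ)) t -
      distFun (densityMeasure (stepFn k v)) t| ≤ C * a n + C / k := by
  have hn' := hτ.approx_isConvexBranched hn
  have hagree : EqOn ((Ioo 0 1).indicator τ) ((Ioo 0 1).indicator (approxMap τ a n))
      (Ico 0 (a n))ᶜ := fun x hx => by
    by_cases hx1 : x ∈ Ioo (0 : ℝ) 1
    · rw [indicator_of_mem hx1, indicator_of_mem hx1]
      exact (if_neg fun hxa => hx ⟨hx1.1.le, hxa⟩).symm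
    · rw [indicator_of_notMem hx1, indicator_of_notMem hx1]
  have happrox := abs_distFun_map_sub_map_le (μ := densityMeasure (stepFn k v))
    hτ.isConvexBranched.measurable hn'.measurable hagree t
  have hulam := hn'.abs_distFun_map_sub_le hk
    ((isUlamDensity_congr (indicator_Ioo_ae_eq _) _).2 hv) hC t
  have hD := densityMeasure_real_le (stepFn_le C.2 hC) (Ico 0 (a n))
  rw [lebI_real_Ico le_rfl (hτ.a_pos n).le (hτ.a_le_one n), sub_zero] at hD
  exact (abs_sub_le _ _ _).trans (add_le_add (happrox.trans hD) hulam)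

theorem map_densityMeasure_eq_of_tendsto (hτ : IsPiecewiseConvexZero τ a) {ι : Type*}
    {l : Filter ι} [l.NeBot] {n k : ι → ℕ} (hn : Tendsto n l atTop) (hk : Tendsto k l atTop)
    {v : (j : ι) → Fin (k j) → ℝ}
    (hv : ∀ᶠ j in l, IsUlamDensity (approxMap τ a (n j)) (k j) (v j)) {f : ℝ → ℝ}
    (hf : Integrable f lebI) (hlim : ∀ A, MeasurableSet A → Tendsto
      (fun j => (densityMeasure (stepFn (k j) (v j))).real A) l
        (𝓝 ((densityMeasure f).real A))) :
    (densityMeasure f).map ((Ioo 0 1).indicator τ) = densityMeasure f := by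
  have hm := hτ.isConvexBranched.measurable
  have := isFiniteMeasure_densityMeasure hf
  obtain ⟨C, hC⟩ := hτ.exists_isBoundedAntitone
  have herror : Tendsto (fun j => C * a (n j) + C / (k j : ℝ)) l (𝓝 0) := by
    simpa only [mul_zero, add_zero, Function.comp_def] using
      ((hτ.a_lim.comp hn).const_mul (C : ℝ)).add
        ((tendsto_const_div_atTop_nhds_zero_nat (C : ℝ)).comp hk)
  refine ext_of_distFun (funext fun t => ?_)
  rw [distFun, map_measureReal_apply hm measurableSet_Iio]
  refine sub_eq_zero.1 (tendsto_nhds_unique ((hlim _ (hm measurableSet_Iio)).sub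
    (hlim _ measurableSet_Iio)) (squeeze_zero_norm' ?_ herror))
  filter_upwards [hn.eventually_ge_atTop 1, hk.eventually_ge_atTop 1, hv] with j hnj hkj hvj
  rw [← map_measureReal_apply hm measurableSet_Iio]
  exact hτ.abs_distFun_map_sub_le hnj hkj hvj (hC _ _ hnj hkj _ hvj).le t

end IsPiecewiseConvexZero

end Invariance

theorem tendsto_atTop_of_frequently_mul_le {e : ℕ → ℝ} {q : ℝ} (he : Monotone e) (h0 : 0 < e 0)
    (hq : 1 < q) (h : ∃ᶠ j in atTop, q * e j ≤ e (j + 1)) : Tendsto e atTop atTop := by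
  refine (tendsto_atTop_of_monotone he).resolve_right ?_
  rintro ⟨L, hL⟩
  have hpos : 0 < L := h0.trans_le (he.ge_of_tendsto hL 0)
  have hle : q * L ≤ L := le_of_tendsto_of_tendsto_of_frequently (hL.const_mul q)
    (hL.comp (tendsto_add_atTop_nat 1)) h
  exact (lt_mul_of_one_lt_left hpos hq).not_ge hle

theorem IsConvexBranch.relative_length_le {g : ℝ → ℝ} {l r c u w : ℝ}
    (h : IsConvexBranch g l r c) (hl : 0 < l) (hu : u ∈ Ico l r) (hw : w ∈ Ico l r) (huw : u ≤ w)
    (hu1 : u ≤ 1) (hgu : 0 < g u) : (1 + l) * ((w - u) / u) ≤ (g w - g u) / g u := by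
  have hstretch : (w - u) * g u ≤ (g w - g u) * (u - l) := by
    linarith [h.map_mul_sub_le hu hw huw]
  rw [← mul_div_assoc, div_le_div_iff₀ (hl.trans_le hu.1) hgu]
  calc (1 + l) * (w - u) * g u = (1 + l) * ((w - u) * g u) := mul_assoc _ _ _
    _ ≤ (1 + l) * ((g w - g u) * (u - l)) := by gcongr
    _ = (g w - g u) * ((1 + l) * (u - l)) := by ring
    _ ≤ (g w - g u) * u :=
      mul_le_mul_of_nonneg_left (by nlinarith)
        (sub_nonneg.2 (h.strictMonoOn.monotoneOn hu hw huw))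

/-- The points to the right of `x` that visit the same branches as `x` during the first `n` steps
of the orbit. -/
def follow (T : ℝ → ℝ) (b : ℕ → ℝ) (n : ℕ) (x : ℝ) : Set ℝ :=
  Ici x ∩ ⋂ j < n, ⋃ m, {y | T^[j] x ∈ Ico (b (m + 1)) (b m) ∧ T^[j] y ∈ Ico (b (m + 1)) (b m)}

theorem mem_follow {T : ℝ → ℝ} {b : ℕ → ℝ} {n : ℕ} {x y : ℝ} : y ∈ follow T b n x ↔ x ≤ y ∧
    ∀ j < n, ∃ m, T^[j] x ∈ Ico (b (m + 1)) (b m) ∧ T^[j] y ∈ Ico (b (m + 1)) (b m) := by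
  simp only [follow, mem_inter_iff, mem_Ici, mem_iInter, mem_iUnion, mem_ofPred_eq]

theorem follow_zero (T : ℝ → ℝ) (b : ℕ → ℝ) (x : ℝ) : follow T b 0 x = Ici x := by
  simp [follow]

theorem antitone_follow (T : ℝ → ℝ) (b : ℕ → ℝ) (x : ℝ) : Antitone fun n => follow T b n x :=
  fun _ _ hij _ hy => mem_follow.2
    ⟨(mem_follow.1 hy).1, fun j hj => (mem_follow.1 hy).2 j (hj.trans_le hij)⟩

theorem mem_follow_succ {T : ℝ → ℝ} {b : ℕ → ℝ} {n m : ℕ} {x y : ℝ} (hxy : x ≤ y)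
    (hx : x ∈ Ico (b (m + 1)) (b m)) (hy : y ∈ Ico (b (m + 1)) (b m))
    (hT : T y ∈ follow T b n (T x)) : y ∈ follow T b (n + 1) x := by
  refine mem_follow.2 ⟨hxy, fun j hj => ?_⟩
  cases j with
  | zero => exact ⟨m, hx, hy⟩
  | succ j => exact (mem_follow.1 hT).2 j (Nat.lt_of_succ_lt_succ hj)

theorem measurableSet_follow {T : ℝ → ℝ} (hT : Measurable T) (b : ℕ → ℝ) (n : ℕ) (x : ℝ) :
    MeasurableSet (follow T b n x) :=
  measurableSet_Ici.inter <| MeasurableSet.iInter fun j => MeasurableSet.iInter fun _ =>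
    MeasurableSet.iUnion fun _ => (MeasurableSet.const _).inter ((hT.iterate j) measurableSet_Ico)

namespace IsConvexBranched

variable {T : ℝ → ℝ} {b c : ℕ → ℝ} {m : ℕ → ℕ} {x y : ℝ}

theorem iterate_lt_iterate (h : IsConvexBranched T b c) (hxy : x < y)
    (hx : ∀ j, T^[j] x ∈ Ico (b (m j + 1)) (b (m j)))
    (hy : ∀ j, T^[j] y ∈ Ico (b (m j + 1)) (b (m j))) (j : ℕ) : T^[j] x < T^[j] y := by
  induction j with
  | zero => exact hxy
  | succ j ih =>
    rw [Function.iterate_succ_apply', Function.iterate_succ_apply']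
    exact (h.branch _).strictMonoOn (hx j) (hy j) ih

/-- The length of `[T^j x, T^j y]` relative to the distance of `T^j x` from `0` never decreases,
and grows by a definite factor each time the orbit visits one of finitely many branches, although
it is bounded there. -/
theorem tendsto_itinerary (h : IsConvexBranched T b c) (hb : ∀ m, 0 < b m) (hxy : x < y)
    (hx : ∀ j, T^[j] x ∈ Ico (b (m j + 1)) (b (m j)))
    (hy : ∀ j, T^[j] y ∈ Ico (b (m j + 1)) (b (m j))) : Tendsto m atTop atTop := by
  have hlt := h.iterate_lt_iterate hxy hx hy
  have hpos : ∀ j, 0 < T^[j] x := fun j => (hb _).trans_le (hx j).1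
  have hle : ∀ j, T^[j] y ≤ 1 := fun j => (hy j).2.le.trans (h.b_le_one _)
  set e : ℕ → ℝ := fun j => (T^[j] y - T^[j] x) / T^[j] x with he
  have he0 : ∀ j, 0 < e j := fun j => div_pos (sub_pos.2 (hlt j)) (hpos j)
  have hstep : ∀ j, (1 + b (m j + 1)) * e j ≤ e (j + 1) := fun j => by
    simp only [he, Function.iterate_succ_apply']
    exact (h.branch _).relative_length_le (hb _) (hx j) (hy j) (hlt j).le
      ((hlt j).le.trans (hle j)) (Function.iterate_succ_apply' T j x ▸ hpos (j + 1))
  have hmono : Monotone e := monotone_nat_of_le_succ fun j =>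
    (le_mul_of_one_le_left (he0 j).le (le_add_of_nonneg_right (hb _).le)).trans (hstep j)
  refine tendsto_atTop.2 fun N => ?_
  by_contra hN
  have hfreq : ∃ᶠ j in atTop, m j < N := (not_eventually.1 hN).mono fun j => not_le.1
  have hunbounded : Tendsto e atTop atTop := by
    refine tendsto_atTop_of_frequently_mul_le hmono (he0 0) (lt_add_of_pos_right 1 (hb N))
      (hfreq.mono fun j hj => (mul_le_mul_of_nonneg_right ?_ (he0 j).le).trans (hstep j))
    linarith [h.anti (Nat.succ_le_of_lt hj)]
  obtain ⟨j, hj, hej⟩ := (hfreq.and_eventually (hunbounded.eventually_gt_atTop (1 / b N))).exists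
  refine hej.not_ge (div_le_div₀ zero_le_one ?_ (hb N) ((h.anti hj).trans (hx j).1))
  linarith [hle j, hpos j]

theorem not_forall_mem_follow (h : IsConvexBranched T b c) (hb : ∀ m, 0 < b m)
    (hc : Tendsto c atTop atTop) (hxy : x < y) : ¬ ∀ n, y ∈ follow T b n x := by
  intro hall
  choose m hx hy using fun j => (mem_follow.1 (hall (j + 1))).2 j j.lt_succ_self
  have hlt := h.iterate_lt_iterate hxy hx hy
  obtain ⟨J, hJ⟩ := eventually_atTop.1
    ((hc.comp (h.tendsto_itinerary hb hxy hx hy)).eventually_ge_atTop 2)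
  have hstep : ∀ i, 2 * (T^[i + J] y - T^[i + J] x) ≤ T^[i + 1 + J] y - T^[i + 1 + J] x := fun i =>
    calc 2 * (T^[i + J] y - T^[i + J] x) ≤ c (m (i + J)) * (T^[i + J] y - T^[i + J] x) :=
          mul_le_mul_of_nonneg_right (hJ _ (Nat.le_add_left J i)) (sub_pos.2 (hlt _)).le
      _ ≤ T (T^[i + J] y) - T (T^[i + J] x) :=
          (h.branch _).mul_sub_le (hx _) (hy _) (hlt _).le
      _ = T^[i + 1 + J] y - T^[i + 1 + J] x := by
          rw [add_right_comm, Function.iterate_succ_apply', Function.iterate_succ_apply']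
  have hunbounded : Tendsto (fun i => T^[i + J] y - T^[i + J] x) atTop atTop :=
    tendsto_atTop_of_frequently_mul_le
      (monotone_nat_of_le_succ fun i => by linarith [hstep i, hlt (i + J)])
      (sub_pos.2 (hlt _)) one_lt_two (Frequently.of_forall hstep)
  obtain ⟨i, hi⟩ := (hunbounded.eventually_gt_atTop 1).exists
  linarith [hb (m (i + J) + 1), (hx (i + J)).1, (hy (i + J)).2, h.b_le_one (m (i + J))]

theorem tendsto_lebI_follow (h : IsConvexBranched T b c) (hb : ∀ m, 0 < b m)
    (hc : Tendsto c atTop atTop) (x : ℝ) :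
    Tendsto (fun n => lebI.real (follow T b n x)) atTop (𝓝 0) := by
  have hinter : ⋂ n, follow T b n x ⊆ {x} := fun y hy => by
    have hall := mem_iInter.1 hy
    by_contra hne
    exact h.not_forall_mem_follow hb hc
      ((mem_follow.1 (hall 0)).1.lt_of_ne (Ne.symm hne)) hall
  have hnull : lebI (⋂ n, follow T b n x) = 0 :=
    measure_mono_null hinter (Measure.restrict_le_self.absolutelyContinuous (by simp))
  have hlim := tendsto_measure_iInter_atTop (μ := lebI)
    (fun n => (measurableSet_follow h.measurable b n x).nullMeasurableSet)
    (antitone_follow T b x) ⟨0, measure_ne_top _ _⟩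
  rw [hnull] at hlim
  exact (ENNReal.tendsto_toReal ENNReal.zero_ne_top).comp hlim

end IsConvexBranched

theorem distFun_restrict_Ici (μ : Measure ℝ) (s t : ℝ) :
    distFun (μ.restrict (Ici s)) t = μ.real (Ico s t) := by
  rw [distFun, measureReal_restrict_apply measurableSet_Iio, inter_comm, Ici_inter_Iio]

theorem concaveOn_distFun_lebI_restrict {x y : ℝ} (hx : 0 ≤ x) (hxy : x ≤ y) (hy : y ≤ 1) :
    ConcaveOn ℝ (Icc x 1) (distFun (lebI.restrict (Ico x y))) := by
  refine (((concaveOn_id (convex_Icc x 1)).inf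
    (concaveOn_const y (convex_Icc x 1))).add_const (-x)).congr fun t ht => ?_
  rw [distFun, measureReal_restrict_apply measurableSet_Iio, inter_comm, Ico_inter_Iio,
    min_comm y t, lebI_real_Ico hx (le_min ht.1 hxy) ((min_le_right _ _).trans hy)]
  rfl

theorem concaveOn_sum_mul {ι : Type*} {D : Set ℝ} {G : ι → ℝ → ℝ} {v : ι → ℝ} (s : Finset ι)
    (hD : Convex ℝ D) (hv : ∀ i, 0 ≤ v i) (hG : ∀ i, ConcaveOn ℝ D (G i)) :
    ConcaveOn ℝ D fun t => ∑ i ∈ s, v i * G i t := by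
  refine Finset.sum_fn s (fun i t => v i * G i t) ▸ ?_
  exact Finset.sum_induction _ (ConcaveOn ℝ D) (fun _ _ => ConcaveOn.add) (concaveOn_const 0 hD)
    fun i _ => (hG i).smul (hv i)

theorem concaveOn_of_forall_exists_abs_sub_le {D : Set ℝ} {F : ℝ → ℝ} (hD : Convex ℝ D)
    (h : ∀ ε > 0, ∃ G, ConcaveOn ℝ D G ∧ ∀ t, |F t - G t| ≤ ε) : ConcaveOn ℝ D F := by
  choose! G hG hFG using h
  have hlim : ∀ t, Tendsto (fun ε => G ε t) (𝓝[>] 0) (𝓝 (F t)) := fun t => by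
    rw [tendsto_iff_dist_tendsto_zero]
    refine squeeze_zero' (Eventually.of_forall fun _ => dist_nonneg) ?_
      (tendsto_id.mono_left nhdsWithin_le_nhds)
    filter_upwards [self_mem_nhdsWithin] with ε hε
    rw [dist_comm]
    exact hFG ε hε t
  refine ⟨hD, fun s hs t ht p q hp hq hpq => ?_⟩
  refine le_of_tendsto_of_tendsto (((hlim s).const_smul p).add ((hlim t).const_smul q)) (hlim _) ?_
  filter_upwards [self_mem_nhdsWithin] with ε hε using (hG ε hε).2 hs ht hp hq hpq

namespace IsConvexBranched

variable {T : ℝ → ℝ} {b c : ℕ → ℝ} {μ : Measure ℝ} [IsFiniteMeasure μ]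

theorem concaveOn_distFun_map_iterate (h : IsConvexBranched T b c) (n : ℕ) (hμ : μ ≪ lebI)
    (hG : ConcaveOn ℝ (Icc 0 1) (distFun μ)) :
    ConcaveOn ℝ (Icc 0 1) (distFun (μ.map T^[n])) := by
  induction n generalizing μ with
  | zero => rwa [Function.iterate_zero, Measure.map_id]
  | succ n ih =>
    rw [Function.iterate_succ, ← Measure.map_map (h.measurable.iterate n) h.measurable]
    exact ih (h.map_ac hμ) (h.concaveOn_distFun_map hμ hG)

theorem concaveOn_distFun_map_restrict_Ici (h : IsConvexBranched T b c) (hμ : μ ≪ lebI) (m : ℕ)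
    (hG : ConcaveOn ℝ (Icc (b m) 1) (distFun μ)) :
    ConcaveOn ℝ (Icc 0 1) (distFun ((μ.restrict (Ici (b m))).map T)) := by
  refine h.concaveOn_distFun_map_of_branches
    (Measure.restrict_le_self.absolutelyContinuous.trans hμ) fun i => ?_
  rcases le_or_gt m i with hmi | him
  · refine (concaveOn_const 0 (convex_Icc _ _)).congr fun t ht => ?_
    rw [distFun_restrict_Ici, Ico_eq_empty_of_le (ht.2.trans (h.anti hmi)), measureReal_empty]
  · have hbm : b m ≤ b (i + 1) := h.anti him
    refine ((hG.subset (Icc_subset_Icc hbm (h.b_le_one i)) (convex_Icc _ _)).add_const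
      (-distFun μ (b m))).congr fun t ht => ?_
    rw [distFun_restrict_Ici, measureReal_Ico μ (hbm.trans ht.1), sub_eq_add_neg, Pi.add_apply]

theorem preimage_Iio_inter_Ico (h : IsConvexBranched T b c) {m : ℕ} {x : ℝ}
    (hx : b (m + 1) ≤ x) (t : ℝ) :
    T ⁻¹' Iio t ∩ Ico x (b m) = Ico x (branchInv T b m t) := by
  have hsub : Ico x (b m) = Ico (b (m + 1)) (b m) ∩ Ici x := by
    rw [Ico_inter_Ici, max_eq_right hx]
  rw [hsub, ← inter_assoc, h.preimage_Iio_inter_branch, Ico_inter_Ici, max_eq_right hx]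

theorem concaveOn_distFun_map_restrict_Ico (h : IsConvexBranched T b c) {m : ℕ} {x : ℝ}
    (hx : x ∈ Ico (b (m + 1)) (b m)) (hG : ConcaveOn ℝ (Icc x (b m)) (distFun μ)) :
    ConcaveOn ℝ (Icc (T x) 1) (distFun ((μ.restrict (Ico x (b m))).map T)) := by
  have hle : ∀ t ∈ Icc (T x) 1, x ≤ branchInv T b m t := fun t ht => h.le_branchInv hx ht.1
  refine ((h.concaveOn_comp_branchInv m hG (distFun_mono μ) (convex_Icc (T x) 1)
    (fun t ht => (h.mapsTo x).1.trans ht.1) hle).add_const (-distFun μ x)).congr fun t ht => ?_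
  rw [distFun.eq_def (Measure.map T _), map_measureReal_apply h.measurable measurableSet_Iio,
    measureReal_restrict_apply (h.measurable measurableSet_Iio), h.preimage_Iio_inter_Ico hx.1,
    measureReal_Ico μ (hle t ht), sub_eq_add_neg, Pi.add_apply]

theorem distFun_map_iterate_succ (h : IsConvexBranched T b c) {x : ℝ} (hx : ∀ᵐ y ∂μ, x ≤ y)
    (s : ℝ) (n : ℕ) (t : ℝ) :
    distFun (μ.map T^[n + 1]) t = distFun (((μ.restrict (Ici s)).map T).map T^[n]) t +
      distFun (((μ.restrict (Ico x s)).map T).map T^[n]) t := by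
  have hsplit : μ.restrict (Ici s) + μ.restrict (Ico x s) = μ := by
    have hIco : μ.restrict (Ico x s) = μ.restrict (Ici s)ᶜ := Measure.restrict_congr_set <| by
      filter_upwards [hx] with y hy
      exact propext ⟨fun hys => not_le.2 hys.2, fun hys => ⟨hy, not_le.1 hys⟩⟩
    rw [hIco, Measure.restrict_add_restrict_compl measurableSet_Ici]
  have hn := h.measurable.iterate n
  conv_lhs => rw [← hsplit, Function.iterate_succ, ← Measure.map_map hn h.measurable,
    Measure.map_add _ _ h.measurable, Measure.map_add _ _ hn]
  exact measureReal_add_apply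

/-- Only the mass that stays in the branch of the left end point `x` of the support can violate
concavity: the images of all other branches have lower end point `0`. -/
theorem exists_concaveOn_approx (h : IsConvexBranched T b c) (n : ℕ) {x : ℝ}
    (hx : x ∈ Ico (0 : ℝ) 1) (hμ : μ ≪ lebI) (hG : ConcaveOn ℝ (Icc x 1) (distFun μ))
    (hxμ : ∀ᵐ y ∂μ, x ≤ y) :
    ∃ G : ℝ → ℝ, ConcaveOn ℝ (Icc 0 1) G ∧
      ∀ t, |distFun (μ.map T^[n]) t - G t| ≤ μ.real (follow T b n x) := by
  induction n generalizing x μ with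
  | zero =>
    refine ⟨fun _ => 0, concaveOn_const 0 (convex_Icc 0 1), fun t => ?_⟩
    rw [Function.iterate_zero, Measure.map_id, sub_zero, follow_zero, distFun,
      abs_of_nonneg measureReal_nonneg]
    exact ENNReal.toReal_mono (measure_ne_top _ _) (measure_mono_ae (hxμ.mono fun y hy _ => hy))
  | succ n ih =>
    rcases hx.1.eq_or_lt with rfl | hx0
    · refine ⟨_, h.concaveOn_distFun_map_iterate (n + 1) hμ hG, fun t => ?_⟩
      rw [sub_self, abs_zero]
      exact measureReal_nonneg
    obtain ⟨m, hm⟩ := h.exists_branch ⟨hx0, hx.2⟩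
    have hac (s : Set ℝ) : (μ.restrict s).map T ≪ lebI :=
      h.map_ac (Measure.restrict_le_self.absolutelyContinuous.trans hμ)
    have hG₁ := h.concaveOn_distFun_map_iterate n (hac _) (h.concaveOn_distFun_map_restrict_Ici hμ m
      (hG.subset (Icc_subset_Icc_left hm.2.le) (convex_Icc _ _)))
    have hmem {y : ℝ} (hy : y ∈ Ico x (b m)) : y ∈ Ico (b (m + 1)) (b m) :=
      ⟨hm.1.trans hy.1, hy.2⟩
    obtain ⟨G₂, hG₂, happrox⟩ := ih (h.mapsTo x) (hac (Ico x (b m)))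
      (h.concaveOn_distFun_map_restrict_Ico hm
        (hG.subset (Icc_subset_Icc_right (h.b_le_one m)) (convex_Icc _ _)))
      ((ae_map_iff h.measurable.aemeasurable measurableSet_Ici).2 <|
        ae_restrict_of_forall_mem measurableSet_Ico fun y hy =>
          (h.branch m).strictMonoOn.monotoneOn hm (hmem hy) hy.1)
    refine ⟨_, hG₁.add hG₂, fun t => ?_⟩
    rw [h.distFun_map_iterate_succ hxμ (b m), Pi.add_apply, add_sub_add_left_eq_sub]
    refine (happrox t).trans ?_
    have hfollow := measurableSet_follow h.measurable b n (T x)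
    rw [map_measureReal_apply h.measurable hfollow,
      measureReal_restrict_apply (h.measurable hfollow)]
    exact measureReal_mono fun y hy => mem_follow_succ hy.2.1 hm (hmem hy.2) hy.1

theorem exists_concaveOn_approx_stepFn (h : IsConvexBranched T b c) (hb : ∀ m, 0 < b m)
    (hc : Tendsto c atTop atTop) {k : ℕ} {v : Fin k → ℝ} (hv : ∀ i, 0 ≤ v i) {ε : ℝ}
    (hε : 0 < ε) : ∃ (n : ℕ) (G : ℝ → ℝ), ConcaveOn ℝ (Icc 0 1) G ∧
      ∀ t, |distFun ((densityMeasure (stepFn k v)).map T^[n]) t - G t| ≤ ε := by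
  have hlim : Tendsto (fun n => ∑ i : Fin k, v i * lebI.real (follow T b n ((i : ℝ) / k))) atTop
      (𝓝 0) := by
    simpa only [mul_zero, Finset.sum_const_zero] using tendsto_finsetSum Finset.univ fun i _ =>
      (h.tendsto_lebI_follow hb hc ((i : Fin k) / k : ℝ)).const_mul (v i)
  obtain ⟨n, hn⟩ := (hlim.eventually_lt_const hε).exists
  have hcell (i : Fin k) : ∃ G : ℝ → ℝ, ConcaveOn ℝ (Icc 0 1) G ∧ ∀ t,
      |distFun ((lebI.restrict (cell k i)).map T^[n]) t - G t|
        ≤ lebI.real (follow T b n ((i : ℝ) / k)) := by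
    obtain ⟨G, hG, happrox⟩ := h.exists_concaveOn_approx n
      ⟨cell_left_nonneg i, (cell_left_lt_right i).trans_le (cell_right_le_one i)⟩
      Measure.restrict_le_self.absolutelyContinuous
      (concaveOn_distFun_lebI_restrict (cell_left_nonneg i) (cell_left_lt_right i).le
        (cell_right_le_one i))
      (ae_restrict_of_forall_mem measurableSet_Ico fun y hy => hy.1)
    refine ⟨G, hG, fun t => (happrox t).trans ?_⟩
    exact ENNReal.toReal_mono (measure_ne_top _ _) (Measure.restrict_apply_le _ _)
  choose G hG happrox using hcell
  refine ⟨n, _, concaveOn_sum_mul Finset.univ (convex_Icc 0 1) hv hG, fun t => ?_⟩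
  have hdist : distFun ((densityMeasure (stepFn k v)).map T^[n]) t
      = ∑ i, v i * distFun ((lebI.restrict (cell k i)).map T^[n]) t := by
    have hpre := (h.measurable.iterate n) (measurableSet_Iio (a := t))
    simp only [distFun, map_measureReal_apply (h.measurable.iterate n) measurableSet_Iio,
      densityMeasure_stepFn_real hv hpre, measureReal_restrict_apply hpre]
  rw [hdist, ← Finset.sum_sub_distrib]
  refine ((Finset.abs_sum_le_sum_abs _ _).trans (Finset.sum_le_sum fun i _ => ?_)).trans hn.le
  rw [← mul_sub, abs_mul, abs_of_nonneg (hv i)]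
  exact mul_le_mul_of_nonneg_left (happrox i t) (hv i)

end IsConvexBranched

theorem exists_stepFn_dist_lt_of_continuousOn {g : ℝ → ℝ} (hg : ContinuousOn g (Icc 0 1)) {ε : ℝ}
    (hε : 0 < ε) : ∃ k : ℕ, ∀ x ∈ Ico (0 : ℝ) 1,
      |max (g x) 0 - stepFn k (fun i => max (g ((i : ℝ) / k)) 0) x| < ε := by
  obtain ⟨δ, hδ, hgδ⟩ := Metric.uniformContinuousOn_iff.1
    (isCompact_Icc.uniformContinuousOn_of_continuous hg) ε hε
  obtain ⟨n, hn⟩ := exists_nat_one_div_lt hδ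
  refine ⟨n + 1, fun x hx => ?_⟩
  obtain ⟨i, hi⟩ := exists_mem_cell n.succ_pos hx
  rw [stepFn_of_mem _ hi]
  refine (abs_max_sub_max_le_abs _ _ _).trans_lt (hgδ x ⟨hx.1, hx.2.le⟩ _
    ⟨cell_left_nonneg i, (cell_left_lt_right i).le.trans (cell_right_le_one i)⟩ ?_)
  rw [Real.dist_eq, abs_of_nonneg (sub_nonneg.2 hi.1)]
  refine lt_trans ?_ hn
  have hright := hi.2
  rw [add_div] at hright
  push_cast at hright ⊢
  linarith

theorem exists_stepFn_integral_abs_sub_le {f : ℝ → ℝ} (hf : Integrable f lebI)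
    (h0 : 0 ≤ᵐ[lebI] f) {ε : ℝ} (hε : 0 < ε) : ∃ (k : ℕ) (v : Fin k → ℝ), (∀ i, 0 ≤ v i) ∧
      ∫ x, |f x - stepFn k v x| ∂lebI ≤ ε := by
  have : lebI.WeaklyRegular := by unfold lebI; infer_instance
  obtain ⟨g, hfg, hgi⟩ := hf.exists_boundedContinuous_integral_sub_le (half_pos hε)
  obtain ⟨k, hk⟩ := exists_stepFn_dist_lt_of_continuousOn
    (g.continuous.continuousOn (s := Icc 0 1)) (half_pos hε)
  refine ⟨k, _, fun i => le_max_right (g ((i : ℝ) / k)) 0, ?_⟩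
  set v : Fin k → ℝ := fun i => max (g ((i : ℝ) / k)) 0
  have hbound : ∀ᵐ x ∂lebI, |f x - stepFn k v x| ≤ ‖f x - g x‖ + ε / 2 := by
    filter_upwards [ae_lebI_mem_Ioo, h0] with x hx hfx
    calc |f x - stepFn k v x| ≤ |max (f x) 0 - max (g x) 0| + |max (g x) 0 - stepFn k v x| := by
          rw [max_eq_left (show 0 ≤ f x from hfx)]
          exact abs_sub_le _ _ _
      _ ≤ ‖f x - g x‖ + ε / 2 :=
          add_le_add (abs_max_sub_max_le_abs _ _ _) (hk x ⟨hx.1.le, hx.2⟩).le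
  have hi : Integrable (fun x => ‖f x - g x‖) lebI := (hf.sub hgi).norm
  calc ∫ x, |f x - stepFn k v x| ∂lebI ≤ ∫ x, (‖f x - g x‖ + ε / 2) ∂lebI :=
        integral_mono_ae (hf.sub (integrable_stepFn k v)).abs (hi.add (integrable_const _)) hbound
    _ = (∫ x, ‖f x - g x‖ ∂lebI) + ε / 2 := by
        rw [integral_add hi (integrable_const _), integral_const, lebI_real_univ, one_smul]
    _ ≤ ε := by linarith

theorem abs_distFun_map_densityMeasure_sub_le {S f g : ℝ → ℝ} (hS : Measurable S)
    (hf : Integrable f lebI) (hf0 : 0 ≤ᵐ[lebI] f) (hg : Integrable g lebI) (hg0 : 0 ≤ᵐ[lebI] g)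
    (t : ℝ) : |distFun ((densityMeasure f).map S) t - distFun ((densityMeasure g).map S) t|
      ≤ ∫ x, |f x - g x| ∂lebI := by
  have hpre := hS (measurableSet_Iio (a := t))
  rw [distFun, distFun, map_measureReal_apply hS measurableSet_Iio,
    map_measureReal_apply hS measurableSet_Iio, densityMeasure_real hf hf0 hpre,
    densityMeasure_real hg hg0 hpre, ← integral_sub hf.integrableOn hg.integrableOn]
  exact abs_integral_le_integral_abs.trans (setIntegral_le_integral (hf.sub hg).abs
    (Eventually.of_forall fun x => abs_nonneg _))

theorem IsConvexBranched.concaveOn_distFun_of_invariant {T : ℝ → ℝ} {b c : ℕ → ℝ}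
    (h : IsConvexBranched T b c) (hb : ∀ m, 0 < b m) (hc : Tendsto c atTop atTop) {f : ℝ → ℝ}
    (hf : Integrable f lebI) (h0 : 0 ≤ᵐ[lebI] f)
    (hinv : (densityMeasure f).map T = densityMeasure f) :
    ConcaveOn ℝ (Icc 0 1) (distFun (densityMeasure f)) := by
  refine concaveOn_of_forall_exists_abs_sub_le (convex_Icc 0 1) fun ε hε => ?_
  obtain ⟨k, v, hv, hfv⟩ := exists_stepFn_integral_abs_sub_le hf h0 (half_pos hε)
  obtain ⟨n, G, hG, hvG⟩ := h.exists_concaveOn_approx_stepFn hb hc hv (half_pos hε)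
  refine ⟨G, hG, fun t => ?_⟩
  have hiter : (densityMeasure f).map T^[n] = densityMeasure f :=
    (MeasurePreserving.iterate ⟨h.measurable, hinv⟩ n).map_eq
  have hdist := abs_distFun_map_densityMeasure_sub_le (h.measurable.iterate n) hf h0
    (integrable_stepFn k v) (Eventually.of_forall (stepFn_nonneg hv)) t
  rw [hiter] at hdist
  linarith [abs_sub_le (distFun (densityMeasure f) t)
    (distFun ((densityMeasure (stepFn k v)).map T^[n]) t) (G t), hvG t]

section InvariantDensity

theorem tendsto_distFun_nhdsGT_zero {μ : Measure ℝ} [IsFiniteMeasure μ] (hμ : μ ≪ lebI) :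
    Tendsto (distFun μ) (𝓝[>] 0) (𝓝 0) := by
  have hlim := tendsto_measure_biInter_gt (μ := μ) (s := Iio) (a := (0 : ℝ))
    (fun _ _ => measurableSet_Iio.nullMeasurableSet) (fun _ _ _ h => Iio_subset_Iio h)
    ⟨1, one_pos, measure_ne_top _ _⟩
  have hnull : μ (⋂ r > (0 : ℝ), Iio r) = 0 := by
    refine measure_eq_zero_iff_ae_notMem.2 (?_)
    filter_upwards [hμ.ae_le ae_lebI_mem_Ioo] with x hx hxI
    exact lt_irrefl x (mem_iInter₂.1 hxI x hx.1)
  rw [hnull] at hlim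
  exact (ENNReal.tendsto_toReal ENNReal.zero_ne_top).comp hlim

theorem frequently_nhdsGT_zero_of_ae_lebI {p : ℝ → Prop} (h : ∀ᵐ x ∂lebI, p x) :
    ∃ᶠ x in 𝓝[>] (0 : ℝ), p x := fun hnot => by
  obtain ⟨δ, hδ, hsub⟩ := mem_nhdsGT_iff_exists_Ioo_subset.1 hnot
  have hmin : 0 < min δ 1 := lt_min hδ one_pos
  have hnull : lebI (Ico 0 (min δ 1)) = 0 := by
    refine measure_eq_zero_iff_ae_notMem.2 ?_
    filter_upwards [h, ae_lebI_mem_Ioo] with x hpx hx hxδ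
    exact hsub ⟨hx.1, hxδ.2.trans_le (min_le_left _ _)⟩ hpx
  have hlength := lebI_real_Ico le_rfl hmin.le (min_le_right δ 1)
  rw [Measure.real, hnull, ENNReal.toReal_zero, sub_zero] at hlength
  exact hmin.ne hlength

theorem ae_integral_le_distFun_of_eq_zero {f : ℝ → ℝ} (hf : Integrable f lebI)
    (h0 : 0 ≤ᵐ[lebI] f) (hc : ConcaveOn ℝ (Icc 0 1) (distFun (densityMeasure f))) :
    ∀ᵐ x ∂lebI, f x = 0 → ∫ y, f y ∂lebI ≤ distFun (densityMeasure f) x := by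
  filter_upwards [ae_lebI_mem_Ioo, ae_hasDerivAt_setIntegral_Iio_lebI hf] with x hx hd hfx
  simp only [← distFun_densityMeasure hf h0, hfx] at hd
  have hslope := hc.slope_le_of_hasDerivAt ⟨hx.1.le, hx.2.le⟩ ⟨zero_le_one, le_rfl⟩ hx.2 hd
  rwa [slope_def_field, div_le_iff₀ (sub_pos.2 hx.2), zero_mul, sub_nonpos,
    distFun_of_one_le (densityMeasure_ac f) le_rfl, densityMeasure_real_univ hf h0] at hslope

theorem integral_eq_zero_of_concaveOn_distFun {f g : ℝ → ℝ} (hf : Integrable f lebI)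
    (hg : Integrable g lebI) (hf0 : 0 ≤ᵐ[lebI] f) (hg0 : 0 ≤ᵐ[lebI] g)
    (hfc : ConcaveOn ℝ (Icc 0 1) (distFun (densityMeasure f)))
    (hgc : ConcaveOn ℝ (Icc 0 1) (distFun (densityMeasure g)))
    (hdisj : ∀ x, f x = 0 ∨ g x = 0) (heq : ∫ x, f x ∂lebI = ∫ x, g x ∂lebI) :
    ∫ x, f x ∂lebI = 0 := by
  -- Where one of the decreasing densities vanishes, its distribution function has reached the total
  -- mass; as the supports are disjoint, this happens arbitrarily close to `0`.
  have := isFiniteMeasure_densityMeasure hf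
  have := isFiniteMeasure_densityMeasure hg
  have hae : ∀ᵐ x ∂lebI, ∫ y, f y ∂lebI ≤
      distFun (densityMeasure f) x + distFun (densityMeasure g) x := by
    filter_upwards [ae_integral_le_distFun_of_eq_zero hf hf0 hfc,
      ae_integral_le_distFun_of_eq_zero hg hg0 hgc] with x hfx hgx
    rcases hdisj x with h | h
    · exact (hfx h).trans (le_add_of_nonneg_right measureReal_nonneg)
    · exact heq.trans_le ((hgx h).trans (le_add_of_nonneg_left measureReal_nonneg))
  have hlim := (tendsto_distFun_nhdsGT_zero (densityMeasure_ac f)).add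
    (tendsto_distFun_nhdsGT_zero (densityMeasure_ac g))
  rw [add_zero] at hlim
  exact (ge_of_tendsto_of_frequently hlim (frequently_nhdsGT_zero_of_ae_lebI hae)).antisymm
    (integral_nonneg_of_ae hf0)

theorem max_zero_eq_indicator {α : Type*} (f : α → ℝ) :
    (fun x => max (f x) 0) = {x | 0 < f x}.indicator f := by
  funext x
  by_cases hx : 0 < f x
  · rw [max_eq_left hx.le, indicator_of_mem (show x ∈ {x | 0 < f x} from hx)]
  · rw [max_eq_right (not_lt.1 hx), indicator_of_notMem (show x ∉ {x | 0 < f x} from hx)]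

theorem posPart_ae_eq_indicator_preimage {α : Type*} [MeasurableSpace α] {μ : Measure α}
    {T : α → α} {f : α → ℝ} (hf : Integrable f μ) (hfm : Measurable f) (hT : Measurable T)
    (hinv : ∀ A, MeasurableSet A → ∫ x in T ⁻¹' A, f x ∂μ = ∫ x in A, f x ∂μ) :
    (fun x => max (f x) 0) =ᵐ[μ] (T ⁻¹' {x | 0 < f x}).indicator f := by
  have hP : MeasurableSet {x | 0 < f x} := measurableSet_lt measurable_const hfm
  have hnonneg : 0 ≤ fun x => max (f x) 0 - (T ⁻¹' {x | 0 < f x}).indicator f x := fun x =>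
    sub_nonneg.2 (indicator_apply_le' (fun _ => le_max_left _ _) fun _ => le_max_right _ _)
  have hzero : ∫ x, (max (f x) 0 - (T ⁻¹' {x | 0 < f x}).indicator f x) ∂μ = 0 := by
    rw [integral_sub hf.pos_part (hf.indicator (hT hP)), integral_indicator (hT hP), hinv _ hP,
      ← integral_indicator hP, sub_eq_zero]
    rw [max_zero_eq_indicator]
  filter_upwards [(integral_eq_zero_iff_of_nonneg hnonneg
    (hf.pos_part.sub (hf.indicator (hT hP)))).1 hzero] with x hx
  exact sub_eq_zero.1 hx

theorem setIntegral_preimage_posPart {α : Type*} [MeasurableSpace α] {μ : Measure α}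
    {T : α → α} {f : α → ℝ} (hf : Integrable f μ) (hfm : Measurable f) (hT : Measurable T)
    (hinv : ∀ A, MeasurableSet A → ∫ x in T ⁻¹' A, f x ∂μ = ∫ x in A, f x ∂μ) (A : Set α)
    (hA : MeasurableSet A) :
    ∫ x in T ⁻¹' A, max (f x) 0 ∂μ = ∫ x in A, max (f x) 0 ∂μ := by
  have hP : MeasurableSet {x | 0 < f x} := measurableSet_lt measurable_const hfm
  rw [integral_congr_ae (ae_restrict_of_ae (posPart_ae_eq_indicator_preimage hf hfm hT hinv)),
    max_zero_eq_indicator, setIntegral_indicator hP, setIntegral_indicator (hT hP),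
    ← preimage_inter, hinv _ (hA.inter hP)]

theorem IsConvexBranched.ae_eq_zero_of_invariant {T : ℝ → ℝ} {b c : ℕ → ℝ}
    (h : IsConvexBranched T b c) (hb : ∀ m, 0 < b m) (hc : Tendsto c atTop atTop) {f : ℝ → ℝ}
    (hf : Integrable f lebI) (hfm : Measurable f)
    (hinv : ∀ A, MeasurableSet A → ∫ x in T ⁻¹' A, f x ∂lebI = ∫ x in A, f x ∂lebI)
    (hzero : ∫ x, f x ∂lebI = 0) : f =ᵐ[lebI] 0 := by
  have hpos_nonneg (g : ℝ → ℝ) : 0 ≤ᵐ[lebI] fun x => max (g x) 0 :=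
    ae_of_all _ fun x => le_max_right _ _
  have hconcave {g : ℝ → ℝ} (hg : Integrable g lebI) (hgm : Measurable g)
      (hginv : ∀ A, MeasurableSet A → ∫ x in T ⁻¹' A, g x ∂lebI = ∫ x in A, g x ∂lebI) :
      ConcaveOn ℝ (Icc 0 1) (distFun (densityMeasure fun x => max (g x) 0)) :=
    h.concaveOn_distFun_of_invariant hb hc hg.pos_part (hpos_nonneg g)
      ((map_densityMeasure_eq_iff hg.pos_part (hpos_nonneg g) h.measurable).2
        (setIntegral_preimage_posPart hg hgm h.measurable hginv))
  have hneg_inv (A : Set ℝ) (hA : MeasurableSet A) :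
      ∫ x in T ⁻¹' A, -f x ∂lebI = ∫ x in A, -f x ∂lebI := by
    rw [integral_neg, integral_neg, hinv A hA]
  have hsplit (x : ℝ) : max (f x) 0 - max (-f x) 0 = f x := max_zero_sub_eq_self (f x)
  have hmass : ∫ x, max (f x) 0 ∂lebI = ∫ x, max (-f x) 0 ∂lebI := by
    rw [← sub_eq_zero, ← integral_sub hf.pos_part hf.neg_part]
    simpa only [hsplit] using hzero
  have hdisj (x : ℝ) : max (f x) 0 = 0 ∨ max (-f x) 0 = 0 :=
    (le_total (f x) 0).imp max_eq_right fun hx => max_eq_right (neg_nonpos.2 hx)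
  have hpos := integral_eq_zero_of_concaveOn_distFun hf.pos_part hf.neg_part (hpos_nonneg f)
    (hpos_nonneg fun x => -f x) (hconcave hf hfm hinv) (hconcave hf.neg hfm.neg hneg_inv) hdisj
    hmass
  filter_upwards [(integral_eq_zero_iff_of_nonneg_ae (hpos_nonneg f) hf.pos_part).1 hpos,
    (integral_eq_zero_iff_of_nonneg_ae (hpos_nonneg fun x => -f x) hf.neg_part).1 (hmass ▸ hpos)]
    with x hx hx'
  exact (hsplit x).symm.trans (sub_eq_zero.2 (hx.trans hx'.symm))

theorem IsInvariantDensity.integral_eq_one {τ : ℝ → ℝ} {f : Lp ℝ 1 lebI}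
    (hf : IsInvariantDensity τ f) : ∫ x, f x ∂lebI = 1 := by
  rw [← hf.2.1, L1.norm_eq_integral_norm]
  refine integral_congr_ae ?_
  filter_upwards [hf.1] with x hx using (Real.norm_of_nonneg hx).symm

namespace IsPiecewiseConvexZero

variable {τ : ℝ → ℝ} {a : ℕ → ℝ}

theorem invariantDensity_unique (hτ : IsPiecewiseConvexZero τ a) {f g : Lp ℝ 1 lebI}
    (hf : IsInvariantDensity τ f) (hg : IsInvariantDensity τ g) : f = g := by
  have h := hτ.isConvexBranched
  have hfi := L1.integrable_coeFn f
  have hgi := L1.integrable_coeFn g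
  have hinv {u : Lp ℝ 1 lebI} (hu : IsInvariantDensity τ u) :=
    (frobeniusPerron_fixed_iff (indicator_Ioo_ae_eq τ).symm h.measurable h.nonsingular u).1 hu.2.2
  refine Lp.ext ((sub_ae_eq_zero f g).1 (h.ae_eq_zero_of_invariant hτ.a_pos hτ.tendsto_branchSlope
    (hfi.sub hgi) ((Lp.stronglyMeasurable f).measurable.sub (Lp.stronglyMeasurable g).measurable)
    (fun A hA => ?_) ?_))
  · simp only [Pi.sub_apply]
    rw [integral_sub hfi.integrableOn hgi.integrableOn,
      integral_sub hfi.integrableOn hgi.integrableOn, hinv hf A hA, hinv hg A hA]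
  · rw [integral_sub' hfi hgi, hf.integral_eq_one, hg.integral_eq_one, sub_self]

theorem isInvariantDensity_of_tendsto (hτ : IsPiecewiseConvexZero τ a) {ι : Type*}
    {l : Filter ι} [l.NeBot] {n k : ι → ℕ} (hn : Tendsto n l atTop) (hk : Tendsto k l atTop)
    {v : (j : ι) → Fin (k j) → ℝ}
    (hv : ∀ᶠ j in l, IsUlamDensity (approxMap τ a (n j)) (k j) (v j)) {f : Lp ℝ 1 lebI}
    (hlim : Tendsto (fun j => stepL1 (k j) (v j)) l (𝓝 f)) : IsInvariantDensity τ f := by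
  have h := hτ.isConvexBranched
  have hfi := L1.integrable_coeFn f
  have h0 : 0 ≤ᵐ[lebI] f := by
    refine (Lp.coeFn_nonneg f).2 (ge_of_tendsto hlim (hv.mono fun j hj => ?_))
    refine (Lp.coeFn_nonneg _).1 ?_
    filter_upwards [stepL1_ae_eq (k j) (v j)] with x hx
    exact (stepFn_nonneg hj.1 x).trans_eq hx.symm
  refine ⟨h0, ?_, ?_⟩
  · refine tendsto_nhds_unique hlim.norm (tendsto_const_nhds.congr' ?_)
    filter_upwards [hv] with j hj using hj.2.2.symm
  · rw [frobeniusPerron_fixed_iff (indicator_Ioo_ae_eq τ).symm h.measurable h.nonsingular,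
      ← map_densityMeasure_eq_iff hfi h0 h.measurable]
    refine hτ.map_densityMeasure_eq_of_tendsto hn hk hv hfi fun A hA => ?_
    rw [densityMeasure_real hfi h0 hA]
    refine (((continuous_setIntegral A).tendsto f).comp hlim).congr' ?_
    filter_upwards [hv] with j hj
    rw [densityMeasure_real (integrable_stepFn _ _) (ae_of_all _ (stepFn_nonneg hj.1)) hA]
    exact integral_congr_ae (ae_restrict_of_ae (stepL1_ae_eq _ _))

end IsPiecewiseConvexZero

end InvariantDensity

section UlamFamily

theorem IsBoundedAntitone.eLpNorm_top_stepFn_le {C : ℝ≥0} {k : ℕ} {v : Fin k → ℝ}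
    (hv : IsBoundedAntitone C v) : eLpNorm (stepFn k v) ∞ lebI ≤ ENNReal.ofReal C := by
  rw [eLpNorm_exponent_top]
  refine eLpNormEssSup_le_of_ae_bound (ae_of_all _ fun x => ?_)
  rw [Real.norm_of_nonneg (stepFn_nonneg hv.nonneg x)]
  exact stepFn_le C.2 hv.le x

/-- A choice of vectors `v n k` whose step functions are the normalized fixed points of the Ulam
operators of the approximations `τ_n`. -/
def IsUlamFamily (τ : ℝ → ℝ) (a : ℕ → ℝ) (v : (n k : ℕ) → Fin k → ℝ) : Prop :=
  ∀ n k : ℕ, 1 ≤ n → 1 ≤ k → IsUlamDensity (approxMap τ a n) k (v n k)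

namespace IsUlamFamily

variable {τ : ℝ → ℝ} {a : ℕ → ℝ} {v : (n k : ℕ) → Fin k → ℝ}

theorem exists_isBoundedAntitone (hv : IsUlamFamily τ a v) (hτ : IsPiecewiseConvexZero τ a) :
    ∃ C : ℝ≥0, ∀ n k : ℕ, 1 ≤ n → 1 ≤ k → IsBoundedAntitone C (v n k) := by
  obtain ⟨C, hC⟩ := hτ.exists_isBoundedAntitone
  exact ⟨C, fun n k hn hk => hC n k hn hk _ (hv n k hn hk)⟩

theorem exists_eLpNorm_top_le (hv : IsUlamFamily τ a v) (hτ : IsPiecewiseConvexZero τ a) :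
    ∃ C : ℝ, ∀ n k : ℕ, 1 ≤ n → 1 ≤ k →
      eLpNorm (stepFn k (v n k)) ∞ lebI ≤ ENNReal.ofReal C := by
  obtain ⟨C, hC⟩ := hv.exists_isBoundedAntitone hτ
  exact ⟨C, fun n k hn hk => (hC n k hn hk).eLpNorm_top_stepFn_le⟩

theorem isCompact_closure_toWeakSpace (hv : IsUlamFamily τ a v)
    (hτ : IsPiecewiseConvexZero τ a) :
    IsCompact (closure {g : WeakSpace ℝ (Lp ℝ 1 lebI) | ∃ n k : ℕ, 1 ≤ n ∧ 1 ≤ k ∧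
      g = toWeakSpace ℝ (Lp ℝ 1 lebI) (stepL1 k (v n k))}) := by
  obtain ⟨C, hC⟩ := hv.exists_isBoundedAntitone hτ
  have himage : {g : WeakSpace ℝ (Lp ℝ 1 lebI) | ∃ n k : ℕ, 1 ≤ n ∧ 1 ≤ k ∧
      g = toWeakSpace ℝ (Lp ℝ 1 lebI) (stepL1 k (v n k))} = toWeakSpace ℝ (Lp ℝ 1 lebI) ''
        {g | ∃ n k : ℕ, 1 ≤ n ∧ 1 ≤ k ∧ g = stepL1 k (v n k)} := by
    ext g
    constructor
    · rintro ⟨n, k, hn, hk, rfl⟩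
      exact ⟨_, ⟨n, k, hn, hk, rfl⟩, rfl⟩
    · rintro ⟨_, ⟨n, k, hn, hk, rfl⟩, rfl⟩
      exact ⟨n, k, hn, hk, rfl⟩
  rw [himage]
  refine IsBoundedAntitone.isCompact_closure_toWeakSpace (C := C) ?_
  rintro _ ⟨n, k, hn, hk, rfl⟩
  exact ⟨k, v n k, hC n k hn hk, rfl⟩

variable {ι : Type*} {l : Filter ι} {n k : ι → ℕ} {f : Lp ℝ 1 lebI}

theorem ae_tendsto_stepFn (hv : IsUlamFamily τ a v) (hτ : IsPiecewiseConvexZero τ a)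
    (hn : ∀ᶠ j in l, 1 ≤ n j) (hk : ∀ᶠ j in l, 1 ≤ k j)
    (hf : Tendsto (fun j => toWeakSpace ℝ (Lp ℝ 1 lebI) (stepL1 (k j) (v (n j) (k j)))) l
      (𝓝 (toWeakSpace ℝ (Lp ℝ 1 lebI) f))) :
    ∀ᵐ x ∂lebI, Tendsto (fun j => stepFn (k j) (v (n j) (k j)) x) l (𝓝 (f x)) := by
  obtain ⟨C, hC⟩ := hv.exists_isBoundedAntitone hτ
  exact IsBoundedAntitone.ae_tendsto_stepFn_of_tendsto_setIntegral
    (hn.mp (hk.mono fun j hkj hnj => hC _ _ hnj hkj))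
    fun t => tendsto_setIntegral_of_tendsto_toWeakSpace hf (Iio t)

theorem tendsto_stepL1 [l.IsCountablyGenerated] (hv : IsUlamFamily τ a v)
    (hτ : IsPiecewiseConvexZero τ a) (hn : ∀ᶠ j in l, 1 ≤ n j) (hk : ∀ᶠ j in l, 1 ≤ k j)
    (hf : Tendsto (fun j => toWeakSpace ℝ (Lp ℝ 1 lebI) (stepL1 (k j) (v (n j) (k j)))) l
      (𝓝 (toWeakSpace ℝ (Lp ℝ 1 lebI) f))) :
    Tendsto (fun j => stepL1 (k j) (v (n j) (k j))) l (𝓝 f) := by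
  obtain ⟨C, hC⟩ := hv.exists_isBoundedAntitone hτ
  exact IsBoundedAntitone.tendsto_stepL1_of_ae
    (hn.mp (hk.mono fun j hkj hnj => hC _ _ hnj hkj)) (hv.ae_tendsto_stepFn hτ hn hk hf)

theorem isInvariantDensity_of_tendsto [l.NeBot] (hv : IsUlamFamily τ a v)
    (hτ : IsPiecewiseConvexZero τ a) (hn : Tendsto n l atTop) (hk : Tendsto k l atTop)
    (hf : Tendsto (fun j => stepL1 (k j) (v (n j) (k j))) l (𝓝 f)) : IsInvariantDensity τ f := by
  refine hτ.isInvariantDensity_of_tendsto hn hk ?_ hf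
  filter_upwards [hn.eventually_ge_atTop 1, hk.eventually_ge_atTop 1] with j hnj hkj
  exact hv _ _ hnj hkj

theorem exists_subseq_tendsto_isInvariantDensity (hv : IsUlamFamily τ a v)
    (hτ : IsPiecewiseConvexZero τ a) {p : ℕ → ℕ × ℕ} (hp : Tendsto p atTop (atTop ×ˢ atTop)) :
    ∃ (f : Lp ℝ 1 lebI) (φ : ℕ → ℕ), IsInvariantDensity τ f ∧
      Tendsto (fun j => stepL1 (p (φ j)).2 (v (p (φ j)).1 (p (φ j)).2)) atTop (𝓝 f) := by
  obtain ⟨C, hC⟩ := hv.exists_isBoundedAntitone hτ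
  have hn := tendsto_fst.comp hp
  have hk := tendsto_snd.comp hp
  have hbounded : ∀ᶠ j in atTop, IsBoundedAntitone C (v (p j).1 (p j).2) := by
    filter_upwards [hn.eventually_ge_atTop 1, hk.eventually_ge_atTop 1] with j hnj hkj
    exact hC _ _ hnj hkj
  obtain ⟨f, φ, hφ, hf⟩ := IsBoundedAntitone.exists_subseq_tendsto_stepL1 hbounded
  exact ⟨f, φ, hv.isInvariantDensity_of_tendsto hτ (hn.comp hφ.tendsto_atTop)
    (hk.comp hφ.tendsto_atTop) hf, hf⟩

theorem exists_isInvariantDensity (hv : IsUlamFamily τ a v) (hτ : IsPiecewiseConvexZero τ a) :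
    ∃ f : Lp ℝ 1 lebI, IsInvariantDensity τ f := by
  obtain ⟨f, _, hf, _⟩ := hv.exists_subseq_tendsto_isInvariantDensity hτ
    (p := fun j => (j, j)) (tendsto_id.prodMk tendsto_id)
  exact ⟨f, hf⟩

theorem tendsto_stepL1_invariantDensity (hv : IsUlamFamily τ a v)
    (hτ : IsPiecewiseConvexZero τ a) (hf : IsInvariantDensity τ f) :
    Tendsto (fun p : ℕ × ℕ => stepL1 p.2 (v p.1 p.2)) (atTop ×ˢ atTop) (𝓝 f) := by
  refine tendsto_of_subseq_tendsto fun p hp => ?_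
  obtain ⟨g, φ, hg, hlim⟩ := hv.exists_subseq_tendsto_isInvariantDensity hτ hp
  exact ⟨φ, hτ.invariantDensity_unique hg hf ▸ hlim⟩

theorem ae_tendsto_stepFn_invariantDensity (hv : IsUlamFamily τ a v)
    (hτ : IsPiecewiseConvexZero τ a) (hf : IsInvariantDensity τ f) :
    ∀ᵐ x ∂lebI, Tendsto (fun p : ℕ × ℕ => stepFn p.2 (v p.1 p.2) x) (atTop ×ˢ atTop)
      (𝓝 (f x)) :=
  hv.ae_tendsto_stepFn hτ (tendsto_fst.eventually_ge_atTop 1) (tendsto_snd.eventually_ge_atTop 1)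
    (((toWeakSpaceCLM ℝ (Lp ℝ 1 lebI)).continuous.tendsto f).comp
      (hv.tendsto_stepL1_invariantDensity hτ hf))

end IsUlamFamily

end UlamFamily

theorem theorem3p5 (τ : ℝ → ℝ) (a : ℕ → ℝ) (hτ : IsPiecewiseConvexZero τ a) :
    -- the normalized fixed point of each Ulam operator exists and is unique
    (∀ n k : ℕ, 1 ≤ n → 1 ≤ k → ∃! v : Fin k → ℝ, IsUlamDensity (approxMap τ a n) k v) ∧
    ∀ v : (n k : ℕ) → Fin k → ℝ,
      (∀ n k : ℕ, 1 ≤ n → 1 ≤ k → IsUlamDensity (approxMap τ a n) k (v n k)) →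
      -- uniform boundedness in `L^∞`
      (∃ C : ℝ, ∀ n k : ℕ, 1 ≤ n → 1 ≤ k →
        eLpNorm (stepFn k (v n k)) ∞ lebI ≤ ENNReal.ofReal C) ∧
      -- relative weak compactness in `L¹`
      IsCompact (closure {g : WeakSpace ℝ (Lp ℝ 1 lebI) | ∃ n k : ℕ, 1 ≤ n ∧ 1 ≤ k ∧
        g = toWeakSpace ℝ (Lp ℝ 1 lebI) (stepL1 k (v n k))}) ∧
      -- weakly convergent sequences from the family
      (∀ (n k : ℕ → ℕ) (f : Lp ℝ 1 lebI), (∀ j, 1 ≤ n j) → (∀ j, 1 ≤ k j) →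
        Tendsto (fun j => toWeakSpace ℝ (Lp ℝ 1 lebI) (stepL1 (k j) (v (n j) (k j)))) atTop
          (𝓝 (toWeakSpace ℝ (Lp ℝ 1 lebI) f)) →
        Tendsto (fun j => stepL1 (k j) (v (n j) (k j))) atTop (𝓝 f) ∧
        (∀ᵐ x ∂lebI, Tendsto (fun j => stepFn (k j) (v (n j) (k j)) x) atTop (𝓝 (f x))) ∧
        (Tendsto n atTop atTop → Tendsto k atTop atTop →
          frobeniusPerron τ f =ᵐ[lebI] f)) ∧
      -- convergence of the whole family to the unique invariant density of `τ`
      ∃ fstar : Lp ℝ 1 lebI, IsInvariantDensity τ fstar ∧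
        (∀ g : Lp ℝ 1 lebI, IsInvariantDensity τ g → g = fstar) ∧
        Tendsto (fun p : ℕ × ℕ => stepL1 p.2 (v p.1 p.2)) (atTop ×ˢ atTop) (𝓝 fstar) ∧
        ∀ᵐ x ∂lebI, Tendsto (fun p : ℕ × ℕ => stepFn p.2 (v p.1 p.2) x) (atTop ×ˢ atTop)
          (𝓝 (fstar x)) := by
  refine ⟨fun n k => hτ.existsUnique_ulamDensity, fun v (hv : IsUlamFamily τ a v) => ?_⟩
  obtain ⟨f, hf⟩ := hv.exists_isInvariantDensity hτ
  refine ⟨hv.exists_eLpNorm_top_le hτ, hv.isCompact_closure_toWeakSpace hτ, ?_,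
    f, hf, fun g hg => hτ.invariantDensity_unique hg hf, hv.tendsto_stepL1_invariantDensity hτ hf,
    hv.ae_tendsto_stepFn_invariantDensity hτ hf⟩
  intro n k g hn hk hweak
  have hn' := Eventually.of_forall (f := atTop) hn
  have hk' := Eventually.of_forall (f := atTop) hk
  have hlim := hv.tendsto_stepL1 hτ hn' hk' hweak
  exact ⟨hlim, hv.ae_tendsto_stepFn hτ hn' hk' hweak, fun hn_top hk_top =>
    (hv.isInvariantDensity_of_tendsto hτ hn_top hk_top hlim).2.2⟩
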